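/- Let $q$ be a prime power and let $m \ge 2$ be an integer. For a linear code $C \subseteq \mathbb F_q^n$ let $A_w$ be the number of codewords of $C$ of Hamming weight $w$ ($0 \le w \le n$). Let $w_0 < w_1 < \dots < w_s$ be the weights $w$ with $A_w \ne 0$ (so $w_0 = 0$), and put $a_i = A_{w_i}$. The sequence $a_0, a_1, \dots, a_s$ is called the nonzero weight distribution of $C$. The code $C$ is called log-concave if $a_i^2 \ge a_{i-1}a_{i+1}$ for all $1 \le i \le s-1$, and $1$-gap log-concave if this inequality fails for exactly one index $i$ with $1 \le i \le s-1$. Let $HRM_q(2,m)$ be the second order homogeneous Reed-Muller code, that is, the code of length $q^m$ consisting of the vectors $(f(x))_{x \in \mathbb F_q^m}$, where $f$ runs over the homogeneous polynomials of degree $2$ in $m$ variables over $\mathbb F_q$ (including $f=0$). Let $PRM_q(2,m)$ be the second order projective Reed-Muller code, that is, the code of length $(q^{m+1}-1)/(q-1)$ consisting of the vectors $(f(v_P))_P$, where $P$ runs over the points of the projective space $PG(m,q)$, $v_P \in \mathbb F_q^{m+1}\setminus\{0\}$ is a fixed vector of homogeneous coordinates of $P$ (chosen arbitrarily), and $f$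 runs over the homogeneous polynomials of degree $2$ in $m+1$ variables over $\mathbb F_q$ (including $f=0$). Then each of the codes $HRM_q(2,m)$ and $PRM_q(2,m)$ is log-concave or $1$-gap log-concave. Moreover, the only index $i$ at which the inequality $a_i^2 \ge a_{i-1}a_{i+1}$ can fail is the one with $w_i = q^m - q^{m-1}$ for $HRM_q(2,m)$, and the one with $w_i = q^m$ for $PRM_q(2,m)$. -/

import Mathlib

noncomputable section

namespace CodeLC

/-- The number `A_w` of codewords of Hamming weight `w` of a linear code `C` whose coordinates
are indexed by the finite type `ι`. -/
def weightCount {F ι : Type*} [Field F] [DecidableEq F] [Fintype ι]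
    (C : Submodule F (ι → F)) (w : ℕ) : ℕ :=
  Set.ncard {c : ι → F | c ∈ C ∧ hammingNorm c = w}

/-- The weights `w ∈ {0, …, n}` with `A_w ≠ 0`, in increasing order (`n` is the length). -/
def weightList {F ι : Type*} [Field F] [DecidableEq F] [Fintype ι]
    (C : Submodule F (ι → F)) : List ℕ :=
  (List.range (Fintype.card ι + 1)).filter fun w => weightCount C w ≠ 0

/-- The nonzero weight distribution: the nonzero values among `A_0, …, A_n`, in order. -/
def nonzeroWeightDist {F ι : Type*} [Field F] [DecidableEq F] [Fintype ι]
    (C : Submodule F (ι → F)) : List ℕ :=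
  (weightList C).map (weightCount C)

/-- `a_i ^ 2 ≥ a_{i-1} a_{i+1}` for every interior index `i` of the finite sequence `a`. -/
def IsLogConcaveSeq (a : List ℕ) : Prop :=
  ∀ i : ℕ, 1 ≤ i → i + 1 < a.length →
    a.getD (i - 1) 0 * a.getD (i + 1) 0 ≤ a.getD i 0 ^ 2

/-- The interior indices at which log-concavity of the finite sequence `a` fails. -/
def gapIndices (a : List ℕ) : Finset ℕ :=
  (Finset.range a.length).filter fun i =>
    1 ≤ i ∧ i + 1 < a.length ∧ a.getD i 0 ^ 2 < a.getD (i - 1) 0 * a.getD (i + 1) 0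

/-- `a` is `k`-gap log-concave: log-concavity fails at exactly `k` interior indices. -/
def IsGapLogConcaveSeq (k : ℕ) (a : List ℕ) : Prop :=
  (gapIndices a).card = k

/-- A linear code is log-concave if its nonzero weight distribution is. -/
def IsLogConcave {F ι : Type*} [Field F] [DecidableEq F] [Fintype ι]
    (C : Submodule F (ι → F)) : Prop :=
  IsLogConcaveSeq (nonzeroWeightDist C)

/-- A linear code is `k`-gap log-concave if its nonzero weight distribution is. -/
def IsGapLogConcave {F ι : Type*} [Field F] [DecidableEq F] [Fintype ι]
    (k : ℕ) (C : Submodule F (ι → F)) : Prop :=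
  IsGapLogConcaveSeq k (nonzeroWeightDist C)

/-- The code of all vectors `(f (p i))_i`, where `f` runs over the homogeneous polynomials of
degree `r` in `n` variables over `F` (including `0`), for a family of points `p i ∈ F ^ n`. -/
def homogeneousEvalCode {F ι : Type*} [Field F] {n : ℕ} (r : ℕ) (p : ι → (Fin n → F)) :
    Submodule F (ι → F) :=
  (MvPolynomial.homogeneousSubmodule (Fin n) F r).map
    (LinearMap.pi fun i => (MvPolynomial.aeval (R := F) (p i)).toLinearMap)

/-- The homogeneous Reed-Muller code `HRM_q(r, m)`: evaluations of the homogeneous polynomials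
of degree `r` in `m` variables at all points of `F ^ m`. -/
def HRM (F : Type*) [Field F] (r m : ℕ) : Submodule F ((Fin m → F) → F) :=
  homogeneousEvalCode r (fun x : Fin m → F => x)

/-- `v` chooses, for each point of the projective space `PG(m, F)`, a nonzero vector of
homogeneous coordinates. -/
def IsRepresentatives {F : Type*} [Field F] {m : ℕ}
    (v : Projectivization F (Fin (m + 1) → F) → (Fin (m + 1) → F)) : Prop :=
  ∀ P, ∃ h : v P ≠ 0, Projectivization.mk F (v P) h = P

/-- The projective Reed-Muller code `PRM_q(r, m)`: evaluations of the homogeneous polynomials of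
degree `r` in `m + 1` variables at the points of `PG(m, F)`, each given by the homogeneous
coordinate vector chosen by `v`. -/
def PRM {F : Type*} [Field F] (r m : ℕ)
    (v : Projectivization F (Fin (m + 1) → F) → (Fin (m + 1) → F)) :
    Submodule F (Projectivization F (Fin (m + 1) → F) → F) :=
  homogeneousEvalCode r v

end CodeLC

end

/-! Codewords correspond bijectively to quadratic forms `Q`, and the weight is an affine decreasing
function of the number of zeros of `Q`. So everything depends on how many forms in `n` variables
have a given `defect`, with `n = m` for `HRM` and `n = m + 1` for `PRM`.

These numbers come from a recursion rather than from a classification of forms. Counting pairs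
(form, nonzero zero) in two ways, with the general linear group transitive on nonzero vectors,
reduces the count to forms vanishing at one fixed vector (`formCount_mul_eq`). Such a form is `Q x +
L x * y`, whose defect is `q` times that of `Q` restricted to `ker L` (`defect_extendForm`). Hence
dimension `n + 2` is governed by `n + 1` and `n` (`formCount_rec_mul`). The recursion is silent only
at the defect of an anisotropic form. Chevalley–Warning excludes that defect in three or more
variables, and the total number of forms settles it in the plane. The solution is `typeCount`
(`formCount_eq_typeCount`).

The defects in decreasing order are hyperbolic of growing rank, zero, elliptic of falling rank.
Inside one type, log-concavity follows from the ratio of consecutive closed forms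
(`typeCount_mul_le`). Next to defect zero, the number of forms of defect zero is bounded by all
forms minus those of largest even rank and nonzero defect, and this bound suffices
(`mul_typeCount_le`). Only the index of defect zero is left unproved, and it corresponds to the
stated weights. -/

namespace FiniteQuadraticForm

/-! ### Quadratic forms on `V × F`, their total number, and the double count of zeros -/

variable {F V W : Type*} [Field F] [AddCommGroup V] [Module F V] [AddCommGroup W] [Module F W]

/-- The number of zeros of a quadratic form. -/
noncomputable def zeroCount (Q : QuadraticForm F V) : ℕ := Nat.card {x // Q x = 0}

/-- The deviation `q * Z - |V|` of the number `Z` of zeros from its average, scaled by `q`. -/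
noncomputable def defect (Q : QuadraticForm F V) : ℤ :=
  (Nat.card F : ℤ) * zeroCount Q - Nat.card V

variable (F V) in
/-- The number of quadratic forms on `V` with the given defect. -/
noncomputable def formCount (d : ℤ) : ℕ := Nat.card {Q : QuadraticForm F V // defect Q = d}

instance [Finite F] [Finite V] : Finite (QuadraticForm F V) := DFunLike.finite _

theorem zeroCount_comp (e : W ≃ₗ[F] V) (Q : QuadraticForm F V) :
    zeroCount (Q.comp e.toLinearMap) = zeroCount Q :=
  Nat.card_congr (e.toEquiv.subtypeEquiv fun x => by simp)

theorem defect_comp (e : W ≃ₗ[F] V) (Q : QuadraticForm F V) :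
    defect (Q.comp e.toLinearMap) = defect Q := by
  rw [defect, defect, zeroCount_comp, Nat.card_congr e.toEquiv]

/-- Transport of quadratic forms along a linear equivalence. -/
def congrForm (e : V ≃ₗ[F] W) : QuadraticForm F V ≃ QuadraticForm F W where
  toFun Q := Q.comp e.symm.toLinearMap
  invFun Q := Q.comp e.toLinearMap
  left_inv Q := by ext; simp
  right_inv Q := by ext; simp

theorem congrForm_apply (e : V ≃ₗ[F] W) (Q : QuadraticForm F V) (x : W) :
    congrForm e Q x = Q (e.symm x) := rfl

theorem defect_congrForm (e : V ≃ₗ[F] W) (Q : QuadraticForm F V) :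
    defect (congrForm e Q) = defect Q := defect_comp e.symm Q

theorem formCount_congr (e : V ≃ₗ[F] W) (d : ℤ) : formCount F V d = formCount F W d :=
  Nat.card_congr ((congrForm e).subtypeEquiv fun Q => by rw [defect_congrForm])

/-- The form `(x, y) ↦ Q x + L x * y + c * y ^ 2`. -/
def extendForm (Q : QuadraticForm F V) (L : V →ₗ[F] F) (c : F) : QuadraticForm F (V × F) :=
  Q.comp (LinearMap.fst F V F) +
    QuadraticMap.linMulLin (L ∘ₗ LinearMap.fst F V F) (LinearMap.snd F V F) +
    c • QuadraticMap.linMulLin (LinearMap.snd F V F) (LinearMap.snd F V F)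

theorem extendForm_apply (Q : QuadraticForm F V) (L : V →ₗ[F] F) (c : F) (x : V × F) :
    extendForm Q L c x = Q x.1 + L x.1 * x.2 + c * (x.2 * x.2) := rfl

/-- Every quadratic form on `V × F` is uniquely of the form `extendForm Q L c`. -/
def extendFormEquiv :
    QuadraticForm F V × (V →ₗ[F] F) × F ≃ QuadraticForm F (V × F) where
  toFun p := extendForm p.1 p.2.1 p.2.2
  invFun Q := (Q.comp (LinearMap.inl F V F),
    (QuadraticMap.polarBilin Q).flip (0, 1) ∘ₗ LinearMap.inl F V F, Q (0, 1))
  left_inv p := by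
    obtain ⟨Q, L, c⟩ := p
    refine Prod.ext ?_ (Prod.ext ?_ ?_)
    · ext x
      simp [extendForm_apply]
    · ext x
      simp [QuadraticMap.polar, extendForm_apply]
      ring
    · simp [extendForm_apply]
  right_inv Q := by
    ext ⟨x, y⟩
    have h := QuadraticMap.map_add Q (x, 0) (y • (0, 1))
    have h2 : ((x, 0) : V × F) + y • (0, 1) = (x, y) := by simp
    rw [h2, QuadraticMap.polar_smul_right, QuadraticMap.map_smul] at h
    rw [h, extendForm_apply]
    simp
    ring

theorem extendFormEquiv_apply (p : QuadraticForm F V × (V →ₗ[F] F) × F) :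
    extendFormEquiv p = extendForm p.1 p.2.1 p.2.2 := rfl

/-- An isomorphism between the two lines extends to the whole space. This transitivity makes the
number of forms of given defect vanishing at a nonzero vector independent of the vector. -/
theorem exists_linearEquiv_apply_eq {x y : V} (hx : x ≠ 0) (hy : y ≠ 0) :
    ∃ g : V ≃ₗ[F] V, g x = y := by
  obtain ⟨g, hg⟩ := Submodule.exists_linearEquiv_restrict_eq
    ((LinearEquiv.toSpanNonzeroSingleton F V x hx).symm ≪≫ₗ
      LinearEquiv.toSpanNonzeroSingleton F V y hy)
  refine ⟨g, ?_⟩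
  have := hg ⟨x, Submodule.mem_span_singleton_self x⟩
  rw [← this]
  have h1 : (⟨x, Submodule.mem_span_singleton_self x⟩ : Submodule.span F {x}) =
    LinearEquiv.toSpanNonzeroSingleton F V x hx 1 := by simp
  rw [h1, LinearEquiv.trans_apply, LinearEquiv.symm_apply_apply]
  simp

theorem card_dual [Finite V] : Nat.card (V →ₗ[F] F) = Nat.card V := by
  have : Module.Finite F V := Module.Finite.of_finite
  exact Nat.card_congr (LinearEquiv.ofFinrankEq _ _ Subspace.dual_finrank_eq).toEquiv

theorem card_form_prod [Finite V] :
    Nat.card (QuadraticForm F (V × F)) = Nat.card (QuadraticForm F V) * (Nat.card V * Nat.card F) := by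
  rw [← Nat.card_congr (extendFormEquiv (F := F) (V := V)), Nat.card_prod, Nat.card_prod, card_dual]

theorem card_form [Finite F] [Finite V] {n : ℕ} (hn : Module.finrank F V = n) :
    Nat.card (QuadraticForm F V) = Nat.card F ^ (n * (n + 1) / 2) := by
  suffices h : Nat.card (QuadraticForm F (Fin n → F)) = Nat.card F ^ (n * (n + 1) / 2) by
    have : Module.Finite F V := Module.Finite.of_finite
    rw [← h]
    exact Nat.card_congr (congrForm (LinearEquiv.ofFinrankEq _ _ (by simpa using hn)))
  clear hn
  induction n with
  | zero =>
    rw [Nat.card_eq_one_iff_unique.2 ⟨⟨fun a b => ?_⟩, ⟨0⟩⟩]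
    · simp
    · ext x
      rw [Subsingleton.elim x 0, QuadraticMap.map_zero, QuadraticMap.map_zero]
  | succ n ih =>
    rw [Nat.card_congr (congrForm (LinearEquiv.ofFinrankEq (Fin (n + 1) → F) ((Fin n → F) × F)
      (by simp))), card_form_prod, ih, Nat.card_fun, Nat.card_fin, ← pow_succ, ← pow_add]
    congr 1
    have : (n + 1) * (n + 1 + 1) = n * (n + 1) + (n + 1) * 2 := by ring
    rw [this, Nat.add_mul_div_right _ _ two_pos]

theorem card_ne_zero_add_one [Finite V] : Nat.card {x : V // x ≠ 0} + 1 = Nat.card V := by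
  classical
  have := Fintype.ofFinite V
  rw [Nat.card_eq_fintype_card, Nat.card_eq_fintype_card]
  have : 0 < Fintype.card V := Fintype.card_pos
  have h : Fintype.card {x : V // x ≠ 0} = Fintype.card V - 1 := by simp
  omega

theorem card_nonzero_zeros [Finite V] (Q : QuadraticForm F V) :
    Nat.card {x : V // x ≠ 0 ∧ Q x = 0} + 1 = zeroCount Q := by
  classical
  have := Fintype.ofFinite V
  rw [zeroCount, Nat.card_eq_fintype_card, Nat.card_eq_fintype_card, Fintype.card_subtype,
    Fintype.card_subtype]
  have : ({x | Q x = 0} : Finset V) = insert 0 ({x | x ≠ 0 ∧ Q x = 0} : Finset V) := by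
    ext x
    by_cases hx : x = 0 <;> simp [hx]
  rw [this, Finset.card_insert_of_notMem (by simp)]

/-- Double counting of the pairs of a form of defect `d` and a nonzero zero of it. -/
theorem formCount_mul_eq [Finite F] [Finite V] {v : V} (hv : v ≠ 0) (d : ℤ) :
    (formCount F V d : ℤ) * (d + Nat.card V - Nat.card F) =
      Nat.card F * ((Nat.card V - 1) *
        Nat.card {Q : QuadraticForm F V // Q v = 0 ∧ defect Q = d}) := by
  classical
  have := Fintype.ofFinite V
  have := Fintype.ofFinite (QuadraticForm F V)
  have key := Finset.sum_card_bipartiteAbove_eq_sum_card_bipartiteBelow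
    (s := ({Q | defect Q = d} : Finset (QuadraticForm F V)))
    (t := ({x | x ≠ 0} : Finset V)) (fun Q x => Q x = 0)
  -- The defect determines the number of zeros, and the zero vector is discarded from it.
  have h1 : ∀ Q ∈ ({Q | defect Q = d} : Finset (QuadraticForm F V)),
      (Nat.card F : ℤ) * ((Finset.bipartiteAbove (fun Q x => Q x = 0)
        ({x | x ≠ 0} : Finset V) Q).card : ℤ) = d + Nat.card V - Nat.card F := by
    intro Q hQ
    have h2 := card_nonzero_zeros Q
    rw [Nat.card_eq_fintype_card, Fintype.card_subtype] at h2
    rw [Finset.bipartiteAbove, Finset.filter_filter, ← (Finset.mem_filter.1 hQ).2, defect, ← h2]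
    push_cast
    ring
  have h3 : ∀ x ∈ ({x | x ≠ 0} : Finset V),
      (Finset.bipartiteBelow (fun Q x => Q x = 0)
        ({Q | defect Q = d} : Finset (QuadraticForm F V)) x).card =
      Nat.card {Q : QuadraticForm F V // Q v = 0 ∧ defect Q = d} := by
    intro x hx
    obtain ⟨g, hg⟩ := exists_linearEquiv_apply_eq (F := F) (Finset.mem_filter.1 hx).2 hv
    rw [Finset.bipartiteBelow, Finset.filter_filter, ← Fintype.card_subtype,
      ← Nat.card_eq_fintype_card]
    refine Nat.card_congr ((congrForm g).subtypeEquiv fun Q => ?_)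
    rw [congrForm_apply, ← hg, g.symm_apply_apply, defect_congrForm, and_comm]
  rw [Finset.sum_congr rfl h3, Finset.sum_const, smul_eq_mul, ← Fintype.card_subtype,
    ← Nat.card_eq_fintype_card (α := {x : V // x ≠ 0})] at key
  have h4 : ((Nat.card {x : V // x ≠ 0} : ℕ) : ℤ) = Nat.card V - 1 := by
    rw [← card_ne_zero_add_one (V := V)]; push_cast; ring
  rw [← h4, ← Nat.cast_mul, ← key, Nat.cast_sum, Finset.mul_sum, Finset.sum_congr rfl h1,
    Finset.sum_const, formCount, Nat.card_eq_fintype_card (α := {Q : QuadraticForm F V // _}),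
    Fintype.card_subtype, nsmul_eq_mul]

end FiniteQuadraticForm

/-! ### Forms vanishing at a fixed vector: reduction to a hyperplane -/

namespace FiniteQuadraticForm

variable {F V W : Type*} [Field F] [AddCommGroup V] [Module F V] [AddCommGroup W] [Module F W]

/-- Over a fixed `x` the equation is linear in `y`: one solution if `L x ≠ 0`, otherwise all of `F`
or nothing according to whether `Q x = 0`. -/
theorem zeroCount_extendForm [Finite F] [Finite V] (Q : QuadraticForm F V) (L : V →ₗ[F] F) :
    zeroCount (extendForm Q L 0) =
      Nat.card F * zeroCount (Q.comp (LinearMap.ker L).subtype) + Nat.card {x : V // L x ≠ 0} := by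
  classical
  have := Fintype.ofFinite V
  have := Fintype.ofFinite F
  have e1 : zeroCount (Q.comp (LinearMap.ker L).subtype) = Nat.card {x : V // L x = 0 ∧ Q x = 0} :=
    Nat.card_congr
      { toFun := fun x => ⟨x.1.1, x.1.2, x.2⟩
        invFun := fun x => ⟨⟨x.1, x.2.1⟩, x.2.2⟩
        left_inv := fun _ => rfl
        right_inv := fun _ => rfl }
  have e2 : zeroCount (extendForm Q L 0) = Nat.card (Σ x : V, {y : F // Q x + L x * y = 0}) :=
    Nat.card_congr
      { toFun := fun x => ⟨x.1.1, x.1.2, by simpa [extendForm_apply] using x.2⟩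
        invFun := fun x => ⟨(x.1, x.2.1), by simpa [extendForm_apply] using x.2.2⟩
        left_inv := fun _ => rfl
        right_inv := fun _ => rfl }
  have e3 : ∀ x : V, Nat.card {y : F // Q x + L x * y = 0} =
      Nat.card F * (if L x = 0 ∧ Q x = 0 then 1 else 0) + if L x ≠ 0 then 1 else 0 := by
    intro x
    by_cases hL : L x = 0
    · by_cases hQ : Q x = 0
      · simp [hL, hQ]
      · simp [hL, hQ]
    · rw [Nat.card_eq_one_iff_unique.2 ⟨⟨fun a b => ?_⟩, ⟨⟨-Q x / L x, by field_simp; ring⟩⟩⟩]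
      · simp [hL]
      · have := a.2.trans b.2.symm
        exact Subtype.ext (mul_left_cancel₀ hL (add_left_cancel this))
  rw [e2, e1, Nat.card_sigma, Finset.sum_congr rfl fun x _ => e3 x, Finset.sum_add_distrib,
    ← Finset.mul_sum, Finset.sum_boole, Finset.sum_boole,
    Nat.card_eq_fintype_card (α := {x : V // L x = 0 ∧ Q x = 0}),
    Nat.card_eq_fintype_card (α := {x : V // L x ≠ 0}), Fintype.card_subtype, Fintype.card_subtype]
  rfl

theorem card_eq_card_ker_mul [Finite V] {L : V →ₗ[F] F} (hL : L ≠ 0) :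
    Nat.card V = Nat.card (LinearMap.ker L) * Nat.card F := by
  rw [Submodule.card_eq_card_quotient_mul_card (LinearMap.ker L), mul_comm,
    Nat.card_congr (L.quotKerEquivOfSurjective (LinearMap.surjective hL)).toEquiv, mul_comm]

/-- Vectors off `ker L` contribute exactly one zero among `q` values of `y`, which is the average,
so they cancel from the defect. The case `L = 0` is included. -/
theorem defect_extendForm [Finite F] [Finite V] (Q : QuadraticForm F V) (L : V →ₗ[F] F) :
    defect (extendForm Q L 0) = Nat.card F * defect (Q.comp (LinearMap.ker L).subtype) := by
  have h1 : Nat.card {x : V // L x ≠ 0} + Nat.card (LinearMap.ker L) = Nat.card V := by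
    classical
    have := Fintype.ofFinite V
    have h2 : Nat.card (LinearMap.ker L) = Nat.card {x : V // L x = 0} := rfl
    rw [h2, Nat.card_eq_fintype_card, Nat.card_eq_fintype_card, Nat.card_eq_fintype_card, add_comm,
      Fintype.card_subtype_compl]
    have := Fintype.card_subtype_le (fun x : V => L x = 0)
    omega
  have h1' : (Nat.card {x : V // L x ≠ 0} : ℤ) = Nat.card V - Nat.card (LinearMap.ker L) := by
    rw [← h1]; push_cast; ring
  rw [defect, defect, zeroCount_extendForm, Nat.card_prod]
  push_cast
  rw [h1']
  ring

theorem defect_extendForm_zero [Finite F] [Finite V] (Q : QuadraticForm F V) :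
    defect (extendForm Q 0 0) = Nat.card F * defect Q := by
  rw [defect_extendForm]
  congr 1
  exact defect_comp (LinearEquiv.ofTop _ LinearMap.ker_zero) Q

theorem card_subtype_comp_addMonoidHom {G H : Type*} [AddGroup G] [AddGroup H] [Finite G]
    (f : G →+ H) (hf : Function.Surjective f) (p : H → Prop) :
    Nat.card {g : G // p (f g)} = Nat.card {h : H // p h} * Nat.card f.ker := by
  rw [← Nat.card_prod]
  let r := Function.surjInv hf
  have hr : ∀ h, f (r h) = h := Function.surjInv_eq hf
  exact Nat.card_congr
    { toFun := fun g => (⟨f g.1, g.2⟩, ⟨-r (f g.1) + g.1, by simp [AddMonoidHom.mem_ker, hr]⟩)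
      invFun := fun x => ⟨r x.1.1 + x.2.1, by
        have := x.2.2
        rw [AddMonoidHom.mem_ker] at this
        rw [map_add, hr, this, add_zero]
        exact x.1.2⟩
      left_inv := fun g => by simp
      right_inv := fun x => by
        have h : f x.2.1 = 0 := x.2.2
        ext <;> simp [hr, h] }

/-- Restriction of quadratic forms to a subspace. -/
def restrictHom (K : Submodule F V) : QuadraticForm F V →+ QuadraticForm F K where
  toFun Q := Q.comp K.subtype
  map_zero' := rfl
  map_add' _ _ := rfl

theorem restrictHom_surjective (K : Submodule F V) : Function.Surjective (restrictHom K) := by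
  intro Q
  obtain ⟨g, hg⟩ := LinearMap.exists_leftInverse_of_injective K.subtype K.ker_subtype
  refine ⟨Q.comp g, ?_⟩
  ext x
  exact congrArg Q (LinearMap.congr_fun hg x)

/-- The number of forms on `V` whose restriction to the hyperplane `ker L` satisfies `p`. -/
theorem card_restrict [Finite F] [Finite V] {L : V →ₗ[F] F} (hL : L ≠ 0)
    (p : QuadraticForm F (LinearMap.ker L) → Prop) :
    Nat.card {Q : QuadraticForm F V // p (Q.comp (LinearMap.ker L).subtype)} =
      Nat.card {Q : QuadraticForm F (LinearMap.ker L) // p Q} * Nat.card V := by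
  have h := card_subtype_comp_addMonoidHom _ (restrictHom_surjective (LinearMap.ker L))
  -- Taking `p` always true turns the fibre count into a comparison of the total numbers of forms,
  -- which yields the size of the kernel.
  have hker : Nat.card (restrictHom (LinearMap.ker L)).ker = Nat.card V := by
    have h1 := h (fun _ => True)
    have h2 : Nat.card (QuadraticForm F V) =
        Nat.card (QuadraticForm F (LinearMap.ker L)) * Nat.card V := by
      have : Module.Finite F V := Module.Finite.of_finite
      rw [Nat.card_congr (congrForm (LinearEquiv.ofFinrankEq V (LinearMap.ker L × F) ?_)),
        card_form_prod, ← card_eq_card_ker_mul hL]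
      rw [Module.finrank_prod, Module.finrank_self, ← LinearMap.finrank_range_add_finrank_ker L,
        LinearMap.range_eq_top.2 (LinearMap.surjective hL), finrank_top, Module.finrank_self,
        add_comm]
    rw [Nat.card_congr (Equiv.subtypeUnivEquiv fun _ => trivial),
      Nat.card_congr (Equiv.subtypeUnivEquiv fun _ => trivial), h2] at h1
    exact (Nat.eq_of_mul_eq_mul_left Nat.card_pos h1).symm
  rw [← hker]
  exact h p

/-- The number of forms on `V × F` of given defect vanishing at `(0, 1)`. -/
theorem card_isotropic [Finite F] [Finite V] {n : ℕ} (hn : Module.finrank F V = n + 1) (d : ℤ) :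
    Nat.card {Q : QuadraticForm F (V × F) // Q (0, 1) = 0 ∧ defect Q = d} =
      Nat.card {Q : QuadraticForm F V // Nat.card F * defect Q = d} +
      (Nat.card V - 1) * (Nat.card V *
        Nat.card {Q : QuadraticForm F (Fin n → F) // Nat.card F * defect Q = d}) := by
  classical
  have : Module.Finite F V := Module.Finite.of_finite
  have : Finite (V →ₗ[F] F) := DFunLike.finite _
  have := Fintype.ofFinite (V →ₗ[F] F)
  -- The value at `(0, 1)` is the coefficient `c`, so vanishing there means `c = 0`, and the forms
  -- can be sorted by `L`.
  have e1 : Nat.card {Q : QuadraticForm F (V × F) // Q (0, 1) = 0 ∧ defect Q = d} =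
      Nat.card (Σ L : V →ₗ[F] F, {Q : QuadraticForm F V // defect (extendForm Q L 0) = d}) := by
    have h0 (Q : QuadraticForm F V) (L : V →ₗ[F] F) : extendForm Q L 0 (0, 1) = 0 := by
      simp [extendForm_apply]
    refine (Nat.card_eq_of_bijective (fun x => ⟨extendForm x.2.1 x.1 0, h0 _ _, x.2.2⟩)
      ⟨?_, ?_⟩).symm
    · rintro ⟨L, Q, hQ⟩ ⟨L', Q', hQ'⟩ h
      have h1 : extendFormEquiv (Q, L, 0) = extendFormEquiv (Q', L', 0) := congrArg Subtype.val h
      have h2 := extendFormEquiv.injective h1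
      simp only [Prod.mk.injEq] at h2
      obtain ⟨rfl, rfl, -⟩ := h2
      rfl
    · rintro ⟨Q, hQ, hd⟩
      obtain ⟨⟨Q', L, c⟩, rfl⟩ := extendFormEquiv.surjective Q
      have hc : c = 0 := by simpa [extendFormEquiv_apply, extendForm_apply] using hQ
      subst hc
      exact ⟨⟨L, Q', hd⟩, rfl⟩
  have e2 : ∀ L : V →ₗ[F] F, L ≠ 0 →
      Nat.card {Q : QuadraticForm F V // defect (extendForm Q L 0) = d} = Nat.card V *
        Nat.card {Q : QuadraticForm F (Fin n → F) // Nat.card F * defect Q = d} := by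
    intro L hL
    simp_rw [defect_extendForm _ L]
    rw [card_restrict hL (fun Q => Nat.card F * defect Q = d), mul_comm]
    congr 1
    have h := LinearMap.finrank_range_add_finrank_ker L
    rw [LinearMap.range_eq_top.2 (LinearMap.surjective hL), finrank_top, Module.finrank_self] at h
    let e : LinearMap.ker L ≃ₗ[F] (Fin n → F) :=
      LinearEquiv.ofFinrankEq _ _ (by rw [Module.finrank_fin_fun]; omega)
    exact Nat.card_congr ((congrForm e).subtypeEquiv fun Q => by rw [defect_congrForm])
  have h5 : (Finset.univ.erase (0 : V →ₗ[F] F)).card = Nat.card V - 1 := by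
    rw [Finset.card_erase_of_mem (Finset.mem_univ _), Finset.card_univ, ← card_dual (F := F),
      Nat.card_eq_fintype_card]
  rw [e1, Nat.card_sigma, ← Finset.add_sum_erase _ _ (Finset.mem_univ (0 : V →ₗ[F] F)),
    Finset.sum_congr rfl fun L hL => e2 L (Finset.ne_of_mem_erase hL), Finset.sum_const, smul_eq_mul, h5]
  simp_rw [defect_extendForm_zero]

end FiniteQuadraticForm

/-! ### The recursion in the dimension and its base cases -/

namespace FiniteQuadraticForm

variable {F V W : Type*} [Field F] [AddCommGroup V] [Module F V] [AddCommGroup W] [Module F W]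

theorem formCount_eq_zero_iff [Finite F] [Finite V] {d : ℤ} :
    formCount F V d = 0 ↔ ∀ Q : QuadraticForm F V, defect Q ≠ d := by
  rw [formCount, Finite.card_eq_zero_iff, isEmpty_subtype]

theorem sum_formCount_le [Finite F] [Finite V] (S : Finset ℤ) :
    ∑ d ∈ S, formCount F V d ≤ Nat.card (QuadraticForm F V) := by
  classical
  have := Fintype.ofFinite (QuadraticForm F V)
  simp_rw [formCount, Nat.card_eq_fintype_card, Fintype.card_subtype]
  rw [← Finset.card_biUnion]
  · exact Finset.card_le_univ _
  · intro a _ b _ hab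
    rw [Function.onFun, Finset.disjoint_filter]
    intro Q _ h h'
    exact hab (h.symm.trans h')

theorem sum_formCount_eq [Finite F] [Finite V] {S : Finset ℤ}
    (hS : ∀ d, formCount F V d ≠ 0 → d ∈ S) :
    ∑ d ∈ S, formCount F V d = Nat.card (QuadraticForm F V) := by
  classical
  have := Fintype.ofFinite (QuadraticForm F V)
  rw [Nat.card_eq_fintype_card, ← Finset.card_univ,
    Finset.card_eq_sum_card_fiberwise (f := defect) (t := S)]
  · simp_rw [formCount, Nat.card_eq_fintype_card, Fintype.card_subtype]
  · intro Q _
    refine hS _ fun h => ?_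
    exact formCount_eq_zero_iff.1 h Q rfl

theorem card_fin_fun {α : Type*} (n : ℕ) : Nat.card (Fin n → α) = Nat.card α ^ n := by
  rw [Nat.card_fun, Nat.card_fin]

theorem formCount_rec [Finite F] (n : ℕ) (d : ℤ) :
    (formCount F (Fin (n + 2) → F) d : ℤ) * (d + (Nat.card F : ℤ) ^ (n + 2) - Nat.card F) =
      Nat.card F * (((Nat.card F : ℤ) ^ (n + 2) - 1) *
        (Nat.card {Q : QuadraticForm F (Fin (n + 1) → F) // Nat.card F * defect Q = d} +
          ((Nat.card F : ℤ) ^ (n + 1) - 1) * ((Nat.card F : ℤ) ^ (n + 1) *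
            Nat.card {Q : QuadraticForm F (Fin n → F) // Nat.card F * defect Q = d}))) := by
  have h := formCount_mul_eq (F := F) (V := (Fin (n + 1) → F) × F) (v := (0, 1)) (by simp) d
  rw [card_isotropic (n := n) (by simp) d, ← formCount_congr (LinearEquiv.ofFinrankEq
    (Fin (n + 2) → F) ((Fin (n + 1) → F) × F) (by simp)), Nat.card_prod, card_fin_fun,
    ← pow_succ] at h
  have h1 : 1 ≤ Nat.card F ^ (n + 1) := Nat.one_le_pow _ _ Nat.card_pos
  push_cast [h1] at h
  exact h

theorem formCount_rec_mul [Finite F] (n : ℕ) (e : ℤ) :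
    (formCount F (Fin (n + 2) → F) (Nat.card F * e) : ℤ) *
        (e + (Nat.card F : ℤ) ^ (n + 1) - 1) =
      ((Nat.card F : ℤ) ^ (n + 2) - 1) * (formCount F (Fin (n + 1) → F) e +
        ((Nat.card F : ℤ) ^ (n + 1) - 1) * ((Nat.card F : ℤ) ^ (n + 1) *
          formCount F (Fin n → F) e)) := by
  have hq : (Nat.card F : ℤ) ≠ 0 := by exact_mod_cast Nat.card_pos.ne'
  have h := formCount_rec (F := F) n (Nat.card F * e)
  simp_rw [mul_right_inj' hq] at h
  apply mul_left_cancel₀ hq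
  rw [formCount, formCount, formCount] at *
  rw [← h]
  ring

/-- A form with a nontrivial zero has defect divisible by `q`. The remaining factor vanishes exactly
at the defect of a form whose only zero is the origin. -/
theorem formCount_rec_not_dvd [Finite F] (n : ℕ) {d : ℤ} (hd : ¬ (Nat.card F : ℤ) ∣ d) :
    (formCount F (Fin (n + 2) → F) d : ℤ) * (d + (Nat.card F : ℤ) ^ (n + 2) - Nat.card F) = 0 := by
  have h := formCount_rec (F := F) n d
  have h0 (k : ℕ) :
      Nat.card {Q : QuadraticForm F (Fin k → F) // (Nat.card F : ℤ) * defect Q = d} = 0 := by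
    rw [Finite.card_eq_zero_iff, isEmpty_subtype]
    rintro Q rfl
    exact hd (dvd_mul_right _ _)
  rw [h, h0, h0]
  simp

theorem defect_of_subsingleton [Subsingleton V] (Q : QuadraticForm F V) :
    defect Q = Nat.card F - 1 := by
  have h (x : V) : Q x = 0 := by rw [Subsingleton.elim x 0, QuadraticMap.map_zero]
  rw [defect, zeroCount, Nat.card_congr (Equiv.subtypeUnivEquiv h),
    Nat.card_eq_one_iff_unique.2 ⟨inferInstance, ⟨(0 : V)⟩⟩]
  simp

theorem formCount_zero [Finite F] (d : ℤ) :
    formCount F (Fin 0 → F) d = if d = Nat.card F - 1 then 1 else 0 := by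
  split_ifs with h
  · rw [formCount, h]
    have : Subsingleton (QuadraticForm F (Fin 0 → F)) := ⟨fun a b => by
      ext x
      rw [Subsingleton.elim x 0, QuadraticMap.map_zero, QuadraticMap.map_zero]⟩
    exact Nat.card_eq_one_iff_unique.2 ⟨inferInstance, ⟨⟨0, defect_of_subsingleton _⟩⟩⟩
  · rw [formCount_eq_zero_iff]
    intro Q hQ
    exact h (hQ ▸ defect_of_subsingleton Q)

theorem defect_zero [Finite V] :
    defect (0 : QuadraticForm F V) = (Nat.card F - 1) * Nat.card V := by
  have h : zeroCount (0 : QuadraticForm F V) = Nat.card V :=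
    Nat.card_congr (Equiv.subtypeUnivEquiv fun _ => rfl)
  rw [defect, h]
  ring

/-- On a line only the zero form has a nontrivial zero. The factor `d` hides the count at defect
zero, which `formCount_one_zero` recovers from the total. -/
theorem formCount_one_mul [Finite F] (d : ℤ) :
    (formCount F (Fin 1 → F) d : ℤ) * d =
      if d = (Nat.card F - 1) * Nat.card F then (Nat.card F - 1) * (Nat.card F : ℤ) else 0 := by
  have h := formCount_mul_eq (F := F) (V := Fin 1 → F) (v := 1) one_ne_zero d
  rw [card_fin_fun, pow_one, add_sub_cancel_right] at h
  have h0 : ∀ Q : QuadraticForm F (Fin 1 → F), Q 1 = 0 → Q = 0 := by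
    intro Q hQ
    ext x
    have hx : x = x 0 • (1 : Fin 1 → F) := by
      ext i
      simp [Subsingleton.elim i 0]
    rw [hx, QuadraticMap.map_smul, hQ]
    simp
  have hdef : defect (0 : QuadraticForm F (Fin 1 → F)) = (Nat.card F - 1) * Nat.card F := by
    rw [defect_zero, card_fin_fun, pow_one]
  rw [h]
  split_ifs with hd
  · have : Nat.card {Q : QuadraticForm F (Fin 1 → F) // Q 1 = 0 ∧ defect Q = d} = 1 :=
      Nat.card_eq_one_iff_unique.2
        ⟨⟨fun a b => Subtype.ext ((h0 _ a.2.1).trans (h0 _ b.2.1).symm)⟩,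
          ⟨⟨0, rfl, hdef.trans hd.symm⟩⟩⟩
    rw [this]
    push_cast
    ring
  · have : Nat.card {Q : QuadraticForm F (Fin 1 → F) // Q 1 = 0 ∧ defect Q = d} = 0 := by
      rw [Finite.card_eq_zero_iff, isEmpty_subtype]
      rintro Q ⟨h1, rfl⟩
      exact hd (by rw [h0 Q h1, hdef])
    rw [this]
    simp

end FiniteQuadraticForm

/-! ### Homogeneous polynomials of degree two as quadratic forms; Chevalley–Warning -/

namespace FiniteQuadraticForm

variable {F : Type*} [Field F]

theorem exists_quadraticForm_of_isHomogeneous {n : ℕ} {f : MvPolynomial (Fin n) F}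
    (hf : f.IsHomogeneous 2) : ∃ Q : QuadraticForm F (Fin n → F), ∀ x, MvPolynomial.eval x f = Q x := by
  classical
  rw [← MvPolynomial.mem_homogeneousSubmodule, ← MvPolynomial.homogeneousSubmodule_one_pow,
    pow_two] at hf
  have hlin : ∀ g ∈ MvPolynomial.homogeneousSubmodule (Fin n) F 1,
      ∃ L : (Fin n → F) →ₗ[F] F, ∀ x, MvPolynomial.eval x g = L x := by
    intro g hg
    rw [MvPolynomial.homogeneousSubmodule_one_eq_span_X] at hg
    induction hg using Submodule.span_induction with
    | mem g hg =>
      obtain ⟨i, rfl⟩ := hg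
      exact ⟨LinearMap.proj i, fun x => by simp⟩
    | zero => exact ⟨0, fun x => by simp⟩
    | add g g' _ _ h h' =>
      obtain ⟨L, hL⟩ := h
      obtain ⟨L', hL'⟩ := h'
      exact ⟨L + L', fun x => by simp [hL, hL']⟩
    | smul a g _ h =>
      obtain ⟨L, hL⟩ := h
      exact ⟨a • L, fun x => by simp [hL]⟩
  refine Submodule.mul_induction_on hf (fun g hg g' hg' => ?_) fun g g' h h' => ?_
  · obtain ⟨L, hL⟩ := hlin g hg
    obtain ⟨L', hL'⟩ := hlin g' hg'
    exact ⟨QuadraticMap.linMulLin L L', fun x => by simp [hL, hL']⟩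
  · obtain ⟨Q, hQ⟩ := h
    obtain ⟨Q', hQ'⟩ := h'
    exact ⟨Q + Q', fun x => by simp [hQ, hQ']⟩

/-- The coefficients come from a bilinear form that need not be symmetric, so no division by two
occurs and characteristic two is covered. -/
theorem exists_isHomogeneous_of_quadraticForm {n : ℕ} (Q : QuadraticForm F (Fin n → F)) :
    ∃ f : MvPolynomial (Fin n) F, f.IsHomogeneous 2 ∧ ∀ x, MvPolynomial.eval x f = Q x := by
  let B := Q.toBilin (Pi.basisFun F (Fin n))
  refine ⟨∑ i, ∑ j, MvPolynomial.C (B (Pi.single i 1) (Pi.single j 1)) *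
    (MvPolynomial.X i * MvPolynomial.X j), ?_, fun x => ?_⟩
  · refine MvPolynomial.IsHomogeneous.sum _ _ _ fun i _ =>
      MvPolynomial.IsHomogeneous.sum _ _ _ fun j _ => ?_
    exact ((MvPolynomial.isHomogeneous_X F i).mul (MvPolynomial.isHomogeneous_X F j)).C_mul _
  · have h := congrArg (fun Q => Q x) (Q.toQuadraticMap_toBilin (Pi.basisFun F (Fin n)))
    rw [← h]
    change _ = B x x
    have h2 := LinearMap.sum_repr_mul_repr_mul (B := B) (Pi.basisFun F (Fin n)) (Pi.basisFun F (Fin n)) x x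
    rw [← h2]
    simp [Finsupp.sum_fintype]
    refine Finset.sum_congr rfl fun i _ => Finset.sum_congr rfl fun j _ => ?_
    ring

/-- By Chevalley–Warning there is no anisotropic form in three or more variables. -/
theorem formCount_anisotropic [Finite F] {n : ℕ} (hn : 3 ≤ n) :
    formCount F (Fin n → F) (Nat.card F - (Nat.card F : ℤ) ^ n) = 0 := by
  classical
  have := Fintype.ofFinite F
  rw [formCount_eq_zero_iff]
  intro Q hQ
  obtain ⟨f, hf, hfQ⟩ := exists_isHomogeneous_of_quadraticForm Q
  -- This defect says that the origin is the only zero, whereas the characteristic divides the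
  -- number of zeros.
  have hz : zeroCount Q = 1 := by
    rw [defect, card_fin_fun] at hQ
    push_cast at hQ
    have hq : (Nat.card F : ℤ) ≠ 0 := by exact_mod_cast Nat.card_pos.ne'
    have : (zeroCount Q : ℤ) = 1 := mul_left_cancel₀ hq (by linarith)
    exact_mod_cast this
  have hp := CharP.char_is_prime F (ringChar F)
  have h := char_dvd_card_solutions (σ := Fin n) (ringChar F) (f := f)
    (lt_of_le_of_lt hf.totalDegree_le (by rw [Fintype.card_fin]; exact hn))
  simp_rw [hfQ] at h
  rw [← Nat.card_eq_fintype_card] at h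
  change ringChar F ∣ zeroCount Q at h
  rw [hz] at h
  exact hp.one_lt.ne' (Nat.dvd_one.1 h)

theorem mem_homogeneousEvalCode_iff {n : ℕ} {ι : Type*} {p : ι → Fin n → F} {c : ι → F} :
    c ∈ CodeLC.homogeneousEvalCode 2 p ↔
      ∃ Q : QuadraticForm F (Fin n → F), (fun i => Q (p i)) = c := by
  rw [CodeLC.homogeneousEvalCode, Submodule.mem_map]
  constructor
  · rintro ⟨f, hf, rfl⟩
    obtain ⟨Q, hQ⟩ := exists_quadraticForm_of_isHomogeneous
      ((MvPolynomial.mem_homogeneousSubmodule _ _).1 hf)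
    refine ⟨Q, funext fun x => ?_⟩
    simp [← hQ, MvPolynomial.aeval_eq_eval]
  · rintro ⟨Q, rfl⟩
    obtain ⟨f, hf, hQ⟩ := exists_isHomogeneous_of_quadraticForm Q
    refine ⟨f, (MvPolynomial.mem_homogeneousSubmodule _ _).2 hf, funext fun x => ?_⟩
    simp [← hQ, MvPolynomial.aeval_eq_eval]

end FiniteQuadraticForm

/-! ### The closed formula for the number of forms of given defect -/

namespace FiniteQuadraticForm

open Finset

/-- The factor `∏_{i < 2h} (q ^ (n - i) - 1) / ∏_{i = 1}^h (q ^ (2 i) - 1)` common to the numbers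
of forms of rank `2 h` of both types. -/
def rankFactor (q : ℚ) (n h : ℕ) : ℚ :=
  (∏ i ∈ range (2 * h), (q ^ (n - i) - 1)) / ∏ i ∈ range h, (q ^ (2 * (i + 1)) - 1)

/-- The number of quadratic forms in `n` variables of rank `2 h` that are hyperbolic (`ε = 1`) or
elliptic (`ε = -1`) modulo their radical. -/
def typeCount (q : ℚ) (n h : ℕ) (ε : ℚ) : ℚ :=
  q ^ h ^ 2 * (q ^ h + ε) / 2 * rankFactor q n h

theorem rankFactor_zero (q : ℚ) (n : ℕ) : rankFactor q n 0 = 1 := by simp [rankFactor]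

theorem rankFactor_eq_zero (q : ℚ) {n h : ℕ} (hn : n < 2 * h) : rankFactor q n h = 0 := by
  rw [rankFactor, prod_eq_zero (mem_range.2 hn) (by simp), zero_div]

theorem rankFactor_succ (q : ℚ) (n h : ℕ) :
    (q ^ (n + 1) - 1) * rankFactor q n h = rankFactor q (n + 1) h * (q ^ (n + 1 - 2 * h) - 1) := by
  have h1 : (q ^ (n + 1) - 1) * ∏ i ∈ range (2 * h), (q ^ (n - i) - 1) =
      (∏ i ∈ range (2 * h), (q ^ (n + 1 - i) - 1)) * (q ^ (n + 1 - 2 * h) - 1) := by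
    rw [← prod_range_succ, prod_range_succ', mul_comm]
    simp
  rw [rankFactor, rankFactor, ← mul_div_assoc, h1]
  ring

theorem one_lt_pow_of_pos {q : ℚ} (hq : 1 < q) {k : ℕ} (hk : 0 < k) : 1 < q ^ k :=
  one_lt_pow₀ hq hk.ne'

theorem rankFactor_succ_succ {q : ℚ} (hq : 1 < q) (n h : ℕ) :
    (q ^ (n + 2) - 1) * (q ^ (n + 1) - 1) * rankFactor q n h =
      rankFactor q (n + 2) (h + 1) * (q ^ (2 * (h + 1)) - 1) := by
  have h1 : ∏ i ∈ range (2 * (h + 1)), (q ^ (n + 2 - i) - 1) =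
      (∏ i ∈ range (2 * h), (q ^ (n - i) - 1)) * (q ^ (n + 1) - 1) * (q ^ (n + 2) - 1) := by
    rw [show 2 * (h + 1) = 2 * h + 1 + 1 by ring, prod_range_succ', prod_range_succ']
    simp
  have h2 : q ^ (2 * (h + 1)) - 1 ≠ 0 := (sub_pos.2 (one_lt_pow_of_pos hq (by omega))).ne'
  rw [rankFactor, rankFactor, h1, prod_range_succ, ← div_div, div_mul_cancel₀ _ h2]
  ring

/-- This is `formCount_rec_mul` at `e = ε * (q - 1) * q ^ (n - h)`, written for the closed formula.
The same `e` belongs to index `h + 1` in dimension `n + 1` and to index `h` in dimension `n`. -/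
theorem typeCount_rec {q : ℚ} (hq : 1 < q) {n h : ℕ} (hh : h ≤ n) {ε : ℚ} (hε : ε ^ 2 = 1) :
    typeCount q (n + 2) (h + 1) ε * (ε * (q - 1) * q ^ (n - h) + q ^ (n + 1) - 1) =
      (q ^ (n + 2) - 1) * (typeCount q (n + 1) (h + 1) ε +
        (q ^ (n + 1) - 1) * (q ^ (n + 1) * typeCount q n h ε)) := by
  have h1 := rankFactor_succ q (n + 1) (h + 1)
  have h2 := rankFactor_succ_succ hq n h
  have e : (q ^ (n + 2) - 1) * (typeCount q (n + 1) (h + 1) ε +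
        (q ^ (n + 1) - 1) * (q ^ (n + 1) * typeCount q n h ε)) =
      q ^ (h + 1) ^ 2 * (q ^ (h + 1) + ε) / 2 *
        ((q ^ (n + 1 + 1) - 1) * rankFactor q (n + 1) (h + 1)) +
      q ^ (n + 1) * (q ^ h ^ 2 * (q ^ h + ε) / 2) *
        ((q ^ (n + 2) - 1) * (q ^ (n + 1) - 1) * rankFactor q n h) := by
    rw [typeCount, typeCount]; ring
  rw [e, h1, h2, typeCount]
  rcases lt_or_ge (n + 2) (2 * (h + 1)) with h3 | h3
  · rw [rankFactor_eq_zero q h3]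
    ring
  · obtain ⟨k, hk⟩ := Nat.exists_eq_add_of_le h3
    -- With `k = n - 2 * h` no truncated subtraction remains, and the claim is a polynomial identity
    -- in `q`, `q ^ h`, `q ^ k`, `q ^ h ^ 2` and `ε`, modulo `ε ^ 2 = 1`.
    have hk1 : n = 2 * h + k := by omega
    subst hk1
    rw [show 2 * h + k - h = h + k by omega, show 2 * h + k + 1 + 1 - 2 * (h + 1) = k by omega]
    have : (ε * (q - 1) * q ^ (h + k) + q ^ (2 * h + k + 1) - 1) * (q ^ (h + 1) ^ 2 * (q ^ (h + 1) + ε))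
        = q ^ (h + 1) ^ 2 * (q ^ (h + 1) + ε) * (q ^ k - 1) +
          q ^ (2 * h + k + 1) * (q ^ h ^ 2 * (q ^ h + ε)) * (q ^ (2 * (h + 1)) - 1) := by
      have a1 : q ^ (h + 1) ^ 2 = q ^ h ^ 2 * (q ^ h) ^ 2 * q := by ring
      have a2 : q ^ (h + k) = q ^ h * q ^ k := by ring
      have a3 : q ^ (2 * h + k + 1) = (q ^ h) ^ 2 * q ^ k * q := by ring
      have a4 : q ^ (2 * (h + 1)) = (q ^ h) ^ 2 * q ^ 2 := by ring
      rw [a1, a2, a3, a4, pow_succ q h]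
      linear_combination (q ^ h ^ 2 * (q ^ h) ^ 3 * q ^ k * q * (q - 1)) * hε
    linear_combination (rankFactor q (2 * h + k + 2) (h + 1) / 2) * this

variable {F V : Type*} [Field F] [AddCommGroup V] [Module F V]

theorem le_defect [Finite F] [Finite V] (Q : QuadraticForm F V) :
    (Nat.card F : ℤ) - Nat.card V ≤ defect Q := by
  have h : 1 ≤ zeroCount Q := by rw [← card_nonzero_zeros]; omega
  have h' : (1 : ℤ) ≤ zeroCount Q := by exact_mod_cast h
  have := mul_le_mul_of_nonneg_left h' (Nat.cast_nonneg (α := ℤ) (Nat.card F))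
  rw [defect]
  linarith

theorem formCount_max [Finite F] [Finite V] :
    formCount F V ((Nat.card F - 1) * Nat.card V) = 1 := by
  refine Nat.card_eq_one_iff_unique.2 ⟨⟨fun a b => ?_⟩, ⟨⟨0, defect_zero⟩⟩⟩
  have key : ∀ Q : QuadraticForm F V, defect Q = (Nat.card F - 1) * Nat.card V → Q = 0 := by
    intro Q hQ
    classical
    have := Fintype.ofFinite V
    have hq : (Nat.card F : ℤ) ≠ 0 := by exact_mod_cast Nat.card_pos.ne'
    have h1 : (zeroCount Q : ℤ) = Nat.card V := by
      apply mul_left_cancel₀ hq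
      rw [defect] at hQ
      linarith
    have h2 : Fintype.card {x // Q x = 0} = Fintype.card V := by
      rw [← Nat.card_eq_fintype_card, ← Nat.card_eq_fintype_card]
      exact_mod_cast h1
    rw [Fintype.card_subtype, ← Finset.card_univ, Finset.card_filter_eq_iff] at h2
    ext x
    exact h2 x (Finset.mem_univ x)
  exact Subtype.ext ((key _ a.2).trans (key _ b.2).symm)

theorem one_lt_card_int [Finite F] : (1 : ℤ) < Nat.card F := by
  exact_mod_cast Finite.one_lt_card (α := F)

theorem formCount_neg_max [Finite F] [Finite V] :
    formCount F V (-((Nat.card F - 1) * Nat.card V)) = 0 := by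
  rw [formCount_eq_zero_iff]
  intro Q hQ
  have h1 := le_defect Q
  have h2 := one_lt_card_int (F := F)
  have h3 : (0 : ℤ) ≤ Nat.card V := Nat.cast_nonneg _
  rw [hQ] at h1
  nlinarith

/-- Through the recursion, an occurring defect `q * e` forces `e` to occur one or two dimensions
lower, unless the factor on the left vanishes. That exception is the anisotropic defect, which
survives only in the plane, as `h = 1`, `ε = -1`. -/
theorem eq_or_eq_of_formCount_ne_zero [Finite F] (n : ℕ) :
    ∀ d : ℤ, formCount F (Fin n → F) d ≠ 0 → d = 0 ∨ ∃ h ≤ n, ∃ ε : ℤ, (ε = 1 ∨ ε = -1) ∧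
      d = ε * (Nat.card F - 1) * (Nat.card F : ℤ) ^ (n - h) := by
  have hq := one_lt_card_int (F := F)
  induction n using Nat.twoStepInduction with
  | zero =>
    intro d hd
    rw [formCount_zero] at hd
    refine Or.inr ⟨0, le_rfl, 1, Or.inl rfl, ?_⟩
    by_contra h
    exact hd (if_neg (by simpa using h))
  | one =>
    intro d hd
    have h := formCount_one_mul (F := F) d
    by_cases h0 : d = 0
    · exact Or.inl h0
    · refine Or.inr ⟨0, Nat.zero_le _, 1, Or.inl rfl, ?_⟩
      by_contra h1
      rw [if_neg (by simpa using h1)] at h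
      rcases mul_eq_zero.1 h with h | h
      · exact hd (by exact_mod_cast h)
      · exact h0 h
  | more n ih0 ih1 =>
    intro d hd
    by_cases hdvd : (Nat.card F : ℤ) ∣ d
    · obtain ⟨e, rfl⟩ := hdvd
      have hrec := formCount_rec_mul (F := F) n e
      by_cases hf : e + (Nat.card F : ℤ) ^ (n + 1) - 1 = 0
      · have he : (Nat.card F : ℤ) * e = Nat.card F - (Nat.card F : ℤ) ^ (n + 2) := by
          have : e = 1 - (Nat.card F : ℤ) ^ (n + 1) := by linarith
          rw [this]; ring
        rcases Nat.eq_zero_or_pos n with rfl | hn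
        · refine Or.inr ⟨1, by omega, -1, Or.inr rfl, ?_⟩
          rw [he]; ring
        · rw [he] at hd
          exact absurd (formCount_anisotropic (F := F) (n := n + 2) (by omega)) hd
      · have h0 : formCount F (Fin (n + 1) → F) e ≠ 0 ∨ formCount F (Fin n → F) e ≠ 0 := by
          by_contra! hcon
          rw [hcon.1, hcon.2] at hrec
          simp only [Nat.cast_zero, mul_zero, add_zero, mul_eq_zero] at hrec
          rcases hrec with hrec | hrec
          · exact hd (by exact_mod_cast hrec)
          · exact hf hrec
        rcases h0 with h0 | h0
        · rcases ih1 e h0 with rfl | ⟨h, hh, ε, hε, rfl⟩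
          · exact Or.inl (mul_zero _)
          · refine Or.inr ⟨h, by omega, ε, hε, ?_⟩
            rw [show n + 2 - h = n + 1 - h + 1 by omega]; ring
        · rcases ih0 e h0 with rfl | ⟨h, hh, ε, hε, rfl⟩
          · exact Or.inl (mul_zero _)
          · refine Or.inr ⟨h + 1, by omega, ε, hε, ?_⟩
            rw [show n + 2 - (h + 1) = n - h + 1 by omega]; ring
    · have hrec := formCount_rec_not_dvd (F := F) n hdvd
      rcases mul_eq_zero.1 hrec with h | h
      · exact absurd (by exact_mod_cast h) hd
      · refine absurd ⟨1 - (Nat.card F : ℤ) ^ (n + 1), ?_⟩ hdvd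
        linear_combination h

theorem formCount_one_zero [Finite F] : (formCount F (Fin 1 → F) 0 : ℤ) = Nat.card F - 1 := by
  have hq := one_lt_card_int (F := F)
  have hne : (0 : ℤ) ≠ (Nat.card F - 1) * Nat.card F := by nlinarith
  have h := sum_formCount_eq (F := F) (V := Fin 1 → F) (S := {0, (Nat.card F - 1) * (Nat.card F : ℤ)})
    (by
      intro d hd
      have h := formCount_one_mul (F := F) d
      by_contra h1
      simp only [Finset.mem_insert, Finset.mem_singleton, not_or] at h1
      rw [if_neg h1.2] at h
      rcases mul_eq_zero.1 h with h | h
      · exact hd (by exact_mod_cast h)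
      · exact h1.1 h)
  have h2 := formCount_max (F := F) (V := Fin 1 → F)
  rw [card_fin_fun, pow_one] at h2
  rw [Finset.sum_pair hne, h2, card_form (n := 1) (by simp)] at h
  simp only [Nat.reduceAdd, one_mul, Nat.reduceDiv, pow_one] at h
  rw [← h]
  push_cast
  ring

theorem formCount_two_zero [Finite F] : (formCount F (Fin 2 → F) 0 : ℤ) = (Nat.card F : ℤ) ^ 2 - 1 := by
  have hq := one_lt_card_int (F := F)
  have h := formCount_rec_mul (F := F) 0 0
  simp only [zero_add, mul_zero, pow_one] at h
  rw [formCount_one_zero, formCount_zero, if_neg (by linarith)] at h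
  apply mul_right_cancel₀ (b := (Nat.card F : ℤ) - 1) (by linarith)
  rw [h]
  push_cast
  ring

theorem formCount_unit_eq_zero [Finite F] (n : ℕ) {ε : ℤ} (hε : ε = 1 ∨ ε = -1) :
    formCount F (Fin (n + 2) → F) (ε * (Nat.card F - 1)) = 0 := by
  have hq := one_lt_card_int (F := F)
  have hdvd : ¬ (Nat.card F : ℤ) ∣ ε * (Nat.card F - 1) := by
    intro h
    have h1 : (Nat.card F : ℤ) ∣ Nat.card F - 1 := by
      rcases hε with rfl | rfl
      · simpa using h
      · rw [neg_one_mul, dvd_neg] at h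
        exact h
    have h2 := Int.le_of_dvd (by linarith) h1
    linarith
  rcases mul_eq_zero.1 (formCount_rec_not_dvd (F := F) n hdvd) with h | h
  · exact_mod_cast h
  · refine absurd ⟨1 - (Nat.card F : ℤ) ^ (n + 1), ?_⟩ hdvd
    linear_combination h

/-- For `h < n` the expression is `-1` modulo `q`; otherwise the sizes of the terms decide. The
excluded case `n = 0`, `ε = -1` really gives zero. -/
theorem recFactor_ne_zero {q : ℤ} (hq : 1 < q) {n h : ℕ} {ε : ℤ} (hε : ε = 1 ∨ ε = -1)
    (hex : n ≠ 0 ∨ ε = 1) : ε * (q - 1) * q ^ (n - h) + q ^ (n + 1) - 1 ≠ 0 := by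
  intro h0
  rcases Nat.eq_zero_or_pos (n - h) with h1 | h1
  · rw [h1] at h0
    rcases hε with rfl | rfl
    · have : 1 < q ^ (n + 1) := one_lt_pow₀ hq (by omega)
      linarith
    · have hn : 1 < n + 1 := by rcases hex with h | h <;> omega
      have := pow_lt_pow_right₀ hq hn
      simp only [pow_zero, pow_one] at this h0
      linarith
  · obtain ⟨k, hk⟩ := Nat.exists_eq_add_of_lt h1
    have h2 : q ∣ 1 := ⟨ε * (q - 1) * q ^ k + q ^ n, by
      rw [hk] at h0
      linear_combination -h0⟩
    have := Int.le_of_dvd one_pos h2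
    linarith

/-- The total number of forms in the plane supplies the number of anisotropic ones, which the
recursion leaves undetermined. -/
theorem sum_formCount_two [Finite F] :
    (1 : ℤ) + formCount F (Fin 2 → F) ((Nat.card F - 1) * Nat.card F) + ((Nat.card F : ℤ) ^ 2 - 1) +
      formCount F (Fin 2 → F) (-((Nat.card F - 1) * Nat.card F)) = (Nat.card F : ℤ) ^ 3 := by
  have hq := one_lt_card_int (F := F)
  have h := sum_formCount_eq (F := F) (V := Fin 2 → F)
    (S := {(Nat.card F - 1) * (Nat.card F : ℤ) ^ 2, (Nat.card F - 1) * (Nat.card F : ℤ), 0,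
      -((Nat.card F - 1) * (Nat.card F : ℤ))}) (by
      intro d hd
      simp only [Finset.mem_insert, Finset.mem_singleton]
      rcases eq_or_eq_of_formCount_ne_zero 2 d hd with rfl | ⟨h, hh, ε, hε, rfl⟩
      · simp
      · interval_cases h
        · rcases hε with rfl | rfl
          · left; ring
          · have := formCount_neg_max (F := F) (V := Fin 2 → F)
            rw [card_fin_fun] at this
            push_cast at this
            rw [Nat.sub_zero, neg_one_mul, neg_mul] at hd
            exact absurd this hd
        · rcases hε with rfl | rfl
          · right; left; simp
          · right; right; right; ring
        · rw [Nat.sub_self, pow_zero, mul_one] at hd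
          exact absurd (formCount_unit_eq_zero 0 hε) hd)
  have hmax := formCount_max (F := F) (V := Fin 2 → F)
  rw [card_fin_fun] at hmax
  push_cast at hmax
  have hpos : 0 < ((Nat.card F : ℤ) - 1) * Nat.card F := by nlinarith
  have hlt : ((Nat.card F : ℤ) - 1) * Nat.card F < (Nat.card F - 1) * (Nat.card F : ℤ) ^ 2 := by
    nlinarith
  rw [Finset.sum_insert, Finset.sum_insert, Finset.sum_insert, Finset.sum_singleton, hmax,
    card_form (n := 2) (by simp)] at h
  · rw [← formCount_two_zero]
    have h' := congrArg (Nat.cast (R := ℤ)) h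
    push_cast at h'
    linear_combination h'
  · simp only [Finset.mem_singleton]
    linarith
  · simp only [Finset.mem_insert, Finset.mem_singleton, not_or]
    constructor <;> linarith
  · simp only [Finset.mem_insert, Finset.mem_singleton, not_or]
    refine ⟨?_, ?_, ?_⟩ <;> linarith

/-- The number of forms in `n` variables of defect `± (q - 1) * q ^ (n - h)`. -/
theorem formCount_eq_typeCount [Finite F] (n : ℕ) :
    ∀ h ≤ n, ∀ ε : ℤ, (ε = 1 ∨ ε = -1) →
      (formCount F (Fin n → F) (ε * (Nat.card F - 1) * (Nat.card F : ℤ) ^ (n - h)) : ℚ) =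
        typeCount (Nat.card F) n h ε := by
  have hq := one_lt_card_int (F := F)
  have hqq : (1 : ℚ) < Nat.card F := by exact_mod_cast hq
  have hzero : ∀ n, ∀ ε : ℤ, (ε = 1 ∨ ε = -1) →
      (formCount F (Fin n → F) (ε * (Nat.card F - 1) * (Nat.card F : ℤ) ^ (n - 0)) : ℚ) =
        typeCount (Nat.card F) n 0 ε := by
    rintro n ε (rfl | rfl)
    · have := formCount_max (F := F) (V := Fin n → F)
      rw [card_fin_fun] at this
      push_cast at this
      rw [one_mul, Nat.sub_zero, this, typeCount, rankFactor_zero]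
      norm_num
    · have := formCount_neg_max (F := F) (V := Fin n → F)
      rw [card_fin_fun] at this
      push_cast at this
      rw [Nat.sub_zero, neg_one_mul, neg_mul, this, typeCount]
      norm_num
  induction n using Nat.twoStepInduction with
  | zero =>
    intro h hh
    obtain rfl : h = 0 := by omega
    exact hzero 0
  | one =>
    intro h hh ε hε
    rcases Nat.eq_zero_or_pos h with rfl | h0
    · exact hzero 1 ε hε
    obtain rfl : h = 1 := by omega
    rw [typeCount, rankFactor_eq_zero _ (by omega), mul_zero, Nat.cast_eq_zero]
    have h1 := formCount_one_mul (F := F) (ε * (Nat.card F - 1))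
    rw [Nat.sub_self, pow_zero, mul_one]
    rw [if_neg] at h1
    · rcases mul_eq_zero.1 h1 with h1 | h1
      · exact_mod_cast h1
      · rcases hε with rfl | rfl <;> exfalso <;> linarith
    · rcases hε with rfl | rfl <;> nlinarith
  | more n ih0 ih1 =>
    have hgen : ∀ h ≤ n, ∀ ε : ℤ, (ε = 1 ∨ ε = -1) → (n ≠ 0 ∨ ε = 1) →
        (formCount F (Fin (n + 2) → F)
          (ε * (Nat.card F - 1) * (Nat.card F : ℤ) ^ (n + 2 - (h + 1))) : ℚ) =
        typeCount (Nat.card F) (n + 2) (h + 1) ε := by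
      intro h hh ε hε hex
      have hne := recFactor_ne_zero (h := h) hq hε hex
      have hneq : (ε : ℚ) * (Nat.card F - 1) * (Nat.card F : ℚ) ^ (n - h) +
          (Nat.card F : ℚ) ^ (n + 1) - 1 ≠ 0 := by exact_mod_cast hne
      have hε2 : (ε : ℚ) ^ 2 = 1 := by rcases hε with rfl | rfl <;> norm_num
      have h0 := ih0 h hh ε hε
      have h1 := ih1 (h + 1) (by omega) ε hε
      rw [Nat.add_sub_add_right] at h1
      have hrec := formCount_rec_mul (F := F) n (ε * (Nat.card F - 1) * (Nat.card F : ℤ) ^ (n - h))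
      have hrecq := congrArg (Int.cast (R := ℚ)) hrec
      push_cast at hrecq
      rw [h0, h1, ← typeCount_rec hqq hh hε2] at hrecq
      rw [← mul_right_cancel₀ hneq hrecq, show n + 2 - (h + 1) = n - h + 1 by omega]
      congr 2
      ring
    intro h hh ε hε
    rcases Nat.eq_zero_or_pos h with rfl | hpos
    · exact hzero (n + 2) ε hε
    obtain ⟨j, rfl⟩ := Nat.exists_eq_add_of_lt hpos
    rw [zero_add] at *
    rcases Nat.lt_or_ge n j with hj | hj
    -- The defect is now `± (q - 1)`, not divisible by `q`, and both sides are zero.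
    · obtain rfl : j = n + 1 := by omega
      rw [Nat.sub_self, pow_zero, mul_one, formCount_unit_eq_zero n hε, typeCount,
        rankFactor_eq_zero _ (by omega), mul_zero, Nat.cast_zero]
    by_cases hex : n ≠ 0 ∨ ε = 1
    · exact hgen j hj ε hε hex
    push Not at hex
    -- Only the anisotropic plane is left; its count is the total minus the other three.
    obtain ⟨rfl, hε1⟩ := hex
    obtain rfl : ε = -1 := hε.resolve_left hε1
    obtain rfl : j = 0 := by omega
    have hplus := hgen 0 le_rfl 1 (Or.inl rfl) (Or.inr rfl)
    have hsum := sum_formCount_two (F := F)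
    simp only [zero_add, Nat.reduceSub, pow_one, one_mul, Int.cast_one, neg_mul,
      Int.cast_neg] at hplus ⊢
    have hsumq := congrArg (Int.cast (R := ℚ)) hsum
    push_cast at hsumq hplus ⊢
    rw [hplus] at hsumq
    have h2 : (Nat.card F : ℚ) ^ 2 - 1 ≠ 0 := by nlinarith
    have hfac : rankFactor (Nat.card F : ℚ) 2 1 = Nat.card F - 1 := by
      simp only [rankFactor, mul_one, prod_range_succ, prod_range_zero, Nat.sub_zero, one_mul,
        zero_add, Nat.reduceSub, pow_one]
      field_simp
    rw [typeCount, hfac] at hsumq ⊢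
    linear_combination hsumq

end FiniteQuadraticForm

/-! ### Inequalities for the closed formula -/

namespace FiniteQuadraticForm

open Finset

theorem rankFactor_pos {q : ℚ} (hq : 1 < q) {n h : ℕ} (hn : 2 * h ≤ n) : 0 < rankFactor q n h := by
  refine div_pos (prod_pos fun i hi => ?_) (prod_pos fun i _ => ?_)
  · rw [mem_range] at hi
    exact sub_pos.2 (one_lt_pow_of_pos hq (by omega))
  · exact sub_pos.2 (one_lt_pow_of_pos hq (by omega))

theorem one_le_pow_of_one_lt {q : ℚ} (hq : 1 < q) (h : ℕ) : 1 ≤ q ^ h := one_le_pow₀ hq.le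

theorem pow_add_sign_pos {q : ℚ} (hq : 1 < q) {h : ℕ} {ε : ℚ} (hε : ε = 1 ∨ ε = -1 ∧ 1 ≤ h) :
    0 < q ^ h + ε := by
  rcases hε with rfl | ⟨rfl, hh⟩
  · have := one_le_pow_of_one_lt hq h
    linarith
  · have := one_lt_pow_of_pos hq hh
    linarith

theorem typeCount_pos {q : ℚ} (hq : 1 < q) {n h : ℕ} (hn : 2 * h ≤ n) {ε : ℚ}
    (hε : ε = 1 ∨ ε = -1 ∧ 1 ≤ h) : 0 < typeCount q n h ε := by
  have := pow_add_sign_pos hq hε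
  have := rankFactor_pos hq hn
  have : 0 < q := by linarith
  unfold typeCount
  positivity

theorem rankFactor_ratio (q : ℚ) (n h : ℕ) :
    rankFactor q n (h + 1) = rankFactor q n h *
      ((q ^ (n - 2 * h) - 1) * (q ^ (n - (2 * h + 1)) - 1) / (q ^ (2 * (h + 1)) - 1)) := by
  rw [rankFactor, rankFactor, show 2 * (h + 1) = 2 * h + 1 + 1 by ring, prod_range_succ,
    prod_range_succ, prod_range_succ _ h, show 2 * h + 1 + 1 = 2 * (h + 1) by ring]
  rw [div_mul_div_comm, mul_assoc]

/-- Log-concavity of the number of forms of fixed type in the rank. -/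
theorem typeCount_mul_le {q : ℚ} (hq : 2 ≤ q) {n h : ℕ} (hn : 2 * (h + 2) ≤ n) {ε : ℚ}
    (hε : ε = 1 ∨ ε = -1 ∧ 1 ≤ h) :
    typeCount q n h ε * typeCount q n (h + 2) ε ≤ typeCount q n (h + 1) ε ^ 2 := by
  have hq1 : 1 < q := by linarith
  obtain ⟨k, rfl⟩ := Nat.exists_eq_add_of_le hn
  have hE0 := rankFactor_pos hq1 (n := 2 * (h + 2) + k) (h := h) (by omega)
  have hE1 := rankFactor_pos hq1 (n := 2 * (h + 2) + k) (h := h + 1) (by omega)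
  have r0 := rankFactor_ratio q (2 * (h + 2) + k) h
  have r1 := rankFactor_ratio q (2 * (h + 2) + k) (h + 1)
  have hx := one_le_pow_of_one_lt hq1 h
  have hy := one_le_pow_of_one_lt hq1 k
  have hs := pow_add_sign_pos hq1 hε
  rw [show 2 * (h + 2) + k - 2 * h = k + 4 by omega,
    show 2 * (h + 2) + k - (2 * h + 1) = k + 3 by omega, pow_add, pow_add,
    show 2 * (h + 1) = h * 2 + 2 by ring, pow_add, pow_mul] at r0
  rw [show 2 * (h + 2) + k - 2 * (h + 1) = k + 2 by omega,
    show 2 * (h + 2) + k - (2 * (h + 1) + 1) = k + 1 by omega, pow_add, pow_add,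
    show q ^ (2 * (h + 1 + 1)) = (q ^ h) ^ 2 * q ^ 4 by ring, pow_one,
    show h + 1 + 1 = h + 2 from rfl] at r1
  have a1 : q ^ (h + 1) ^ 2 = q ^ h ^ 2 * (q ^ h) ^ 2 * q := by ring
  have a2 : q ^ (h + 2) ^ 2 = q ^ h ^ 2 * (q ^ h) ^ 4 * q ^ 4 := by ring
  rw [typeCount, typeCount, typeCount, a1, a2, r1, pow_succ q h, pow_add q h 2]
  generalize rankFactor q (2 * (h + 2) + k) (h + 1) = E1 at *
  generalize rankFactor q (2 * (h + 2) + k) h = E0 at *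
  have ha : 0 < q ^ h ^ 2 := by positivity
  generalize q ^ h ^ 2 = a at *
  have hε' : ε = 1 ∨ ε = -1 := by tauto
  generalize q ^ h = x at *
  generalize q ^ k = y at *
  have hyq : 2 ≤ y * q := by nlinarith
  have hxq : 2 ≤ x * q := by nlinarith
  have hd0 : 0 < x ^ 2 * q ^ 2 - 1 := by nlinarith
  have hd1 : 0 < x ^ 2 * q ^ 4 - 1 := by nlinarith [sq_nonneg q]
  set R1 := (y * q ^ 2 - 1) * (y * q - 1) / (x ^ 2 * q ^ 4 - 1) with hR1
  set R0 := (y * q ^ 4 - 1) * (y * q ^ 3 - 1) / (x ^ 2 * q ^ 2 - 1) with hR0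
  have hR1pos : 0 ≤ R1 := by
    apply div_nonneg (mul_nonneg _ _) hd1.le <;> nlinarith
  -- Two numerator factors and the denominator each change by a factor at least `q ^ 2`. The powers
  -- `q ^ h ^ 2` cost `q ^ 2` of the gain, so `q ^ 4` remains for the sign factors in `hsign`.
  have hR : q ^ 6 * R1 ≤ R0 := by
    rw [hR1, hR0, ← mul_div_assoc, div_le_div_iff₀ hd1 hd0]
    have b1 : q ^ 2 * (y * q ^ 2 - 1) ≤ y * q ^ 4 - 1 := by nlinarith
    have b2 : q ^ 2 * (y * q - 1) ≤ y * q ^ 3 - 1 := by nlinarith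
    have b3 : q ^ 2 * (x ^ 2 * q ^ 2 - 1) ≤ x ^ 2 * q ^ 4 - 1 := by nlinarith
    have c1 : 0 ≤ y * q ^ 2 - 1 := by nlinarith
    have c2 : 0 ≤ y * q - 1 := by nlinarith
    have b4 := mul_le_mul (mul_le_mul b1 b2 (by positivity) (le_trans (by positivity) b1)) b3
      (by positivity) (mul_nonneg (le_trans (by positivity) b1) (le_trans (by positivity) b2))
    calc _ = q ^ 2 * (y * q ^ 2 - 1) * (q ^ 2 * (y * q - 1)) * (q ^ 2 * (x ^ 2 * q ^ 2 - 1)) := by ring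
      _ ≤ _ := b4
  have hsign : (x + ε) * (x * q ^ 2 + ε) ≤ q ^ 4 * (x * q + ε) ^ 2 := by
    have d1 : x + ε ≤ x * q + ε := by nlinarith
    have d2 : x * q ^ 2 + ε ≤ q ^ 4 * (x * q + ε) := by
      have : 4 ≤ q ^ 2 := by nlinarith
      rcases hε' with rfl | rfl
      · nlinarith [mul_nonneg (by linarith : (0 : ℚ) ≤ x * q) (by linarith : 0 ≤ q)]
      · have e1 : q ≤ q ^ 4 := le_self_pow₀ hq1.le (by norm_num)
        have e2 : 2 * q ≤ q ^ 4 := by nlinarith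
        have e3 := mul_le_mul_of_nonneg_right e2 (by linarith : 0 ≤ x * q - 1)
        have e4 : 0 ≤ q * (x * q - 2) := mul_nonneg (by linarith) (by linarith)
        linarith
    have d3 : 0 ≤ x * q ^ 2 + ε := by nlinarith
    calc (x + ε) * (x * q ^ 2 + ε) ≤ (x * q + ε) * (q ^ 4 * (x * q + ε)) :=
          mul_le_mul d1 d2 d3 (by linarith)
      _ = _ := by ring
  have hfin : q ^ 2 * ((x + ε) * (x * q ^ 2 + ε)) * R1 ≤ (x * q + ε) ^ 2 * R0 := by
    calc q ^ 2 * ((x + ε) * (x * q ^ 2 + ε)) * R1 ≤ q ^ 2 * (q ^ 4 * (x * q + ε) ^ 2) * R1 := by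
          gcongr
      _ = (x * q + ε) ^ 2 * (q ^ 6 * R1) := by ring
      _ ≤ _ := by gcongr
  have hK : 0 ≤ a ^ 2 * x ^ 4 * q ^ 2 / 4 * (E0 * E1) := by positivity
  have := mul_le_mul_of_nonneg_left hfin hK
  calc _ = a ^ 2 * x ^ 4 * q ^ 2 / 4 * (E0 * E1) *
          (q ^ 2 * ((x + ε) * (x * q ^ 2 + ε)) * R1) := by ring
    _ ≤ _ := this
    _ = a ^ 2 * x ^ 4 * q ^ 2 / 4 * (x * q + ε) ^ 2 * E1 * (E0 * R0) := by ring
    _ = _ := by rw [← r0]; ring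

/-- Here the rank factor is a product of terms `q ^ (2 * j + 1) - 1`, and the bound is uniform for
it relative to `q ^ (h + 1) ^ 2`. The summand `q ^ 3`, negligible for large `h`, gives equality at
`h = 0` and lets the induction close. -/
theorem le_rankFactor_even {q : ℚ} (hq : 2 ≤ q) (h : ℕ) :
    q ^ (h + 1) ^ 2 * ((q ^ 3 - q - 1) * q ^ (2 * h + 3) + q ^ 3) ≤
      rankFactor q (2 * (h + 1)) (h + 1) * (q ^ 2 * (q + 1) * q ^ (2 * h + 3)) := by
  have hq1 : 1 < q := by linarith
  have hrec (j : ℕ) : rankFactor q (2 * (j + 1)) (j + 1) =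
      (q ^ (2 * j + 1) - 1) * rankFactor q (2 * j) j := by
    have h1 := rankFactor_succ_succ hq1 (2 * j) j
    have h2 : q ^ (2 * (j + 1)) - 1 ≠ 0 := (sub_pos.2 (one_lt_pow_of_pos hq1 (by omega))).ne'
    apply mul_right_cancel₀ h2
    rw [show 2 * (j + 1) = 2 * j + 2 by ring] at *
    rw [← h1]
    ring
  induction h with
  | zero =>
    rw [hrec, rankFactor_zero]
    apply le_of_eq
    ring
  | succ h ih =>
    rw [hrec (h + 1), show 2 * (h + 1) + 1 = 2 * h + 3 by ring,
      show 2 * (h + 1) + 3 = 2 * h + 3 + 2 by ring, pow_add q (2 * h + 3),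
      show (h + 1 + 1) ^ 2 = (h + 1) ^ 2 + (2 * h + 3) by ring, pow_add q ((h + 1) ^ 2)]
    have hY : q ^ 3 ≤ q ^ (2 * h + 3) := pow_le_pow_right₀ hq1.le (by omega)
    have ha : 0 < q ^ (h + 1) ^ 2 := by positivity
    generalize q ^ (2 * h + 3) = Y at *
    generalize q ^ (h + 1) ^ 2 = a at *
    generalize rankFactor q (2 * (h + 1)) (h + 1) = E at *
    have h8 : 1 ≤ q ^ 3 := one_le_pow₀ hq1.le
    have h1 := mul_le_mul_of_nonneg_left ih (mul_nonneg (by linarith : 0 ≤ Y - 1) (sq_nonneg q))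
    have h2 : 0 ≤ a * (q ^ 2 * (Y - q ^ 3)) :=
      mul_nonneg ha.le (mul_nonneg (sq_nonneg q) (by linarith))
    linarith

theorem le_rankFactor_odd {q : ℚ} (hq : 2 ≤ q) (h : ℕ) :
    q ^ (h ^ 2 + 2 * h) * ((q ^ 3 - q - 1) * q ^ (2 * h + 1) + q) ≤
      rankFactor q (2 * h + 1) h * (q * (q ^ 2 - 1) * q ^ (2 * h + 1)) := by
  have hq1 : 1 < q := by linarith
  have hrec (j : ℕ) : rankFactor q (2 * (j + 1) + 1) (j + 1) =
      (q ^ (2 * j + 3) - 1) * rankFactor q (2 * j + 1) j := by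
    have h1 := rankFactor_succ_succ hq1 (2 * j + 1) j
    have h2 : q ^ (2 * (j + 1)) - 1 ≠ 0 := (sub_pos.2 (one_lt_pow_of_pos hq1 (by omega))).ne'
    apply mul_right_cancel₀ h2
    rw [show 2 * (j + 1) + 1 = 2 * j + 1 + 2 by ring, ← h1]
    ring
  induction h with
  | zero =>
    rw [rankFactor_zero]
    apply le_of_eq
    ring
  | succ h ih =>
    rw [hrec h, show 2 * h + 3 = 2 * h + 1 + 2 by ring,
      show 2 * (h + 1) + 1 = 2 * h + 1 + 2 by ring,
      show (h + 1) ^ 2 + 2 * (h + 1) = h ^ 2 + 2 * h + (2 * h + 1 + 2) by ring,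
      pow_add q (h ^ 2 + 2 * h), pow_add q (2 * h + 1)]
    have hY : q ^ 1 ≤ q ^ (2 * h + 1) := pow_le_pow_right₀ hq1.le (by omega)
    rw [pow_one] at hY
    have ha : 0 < q ^ (h ^ 2 + 2 * h) := by positivity
    generalize q ^ (2 * h + 1) = Y at *
    generalize q ^ (h ^ 2 + 2 * h) = a at *
    generalize rankFactor q (2 * h + 1) h = E at *
    have h0 : 0 ≤ Y * q ^ 2 - 1 := by nlinarith
    have h1 := mul_le_mul_of_nonneg_left ih (mul_nonneg h0 (sq_nonneg q))
    have h2 : 0 ≤ a * (q ^ 2 * (Y - q)) :=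
      mul_nonneg ha.le (mul_nonneg (sq_nonneg q) (by linarith))
    linarith

/-- The left side is the number of all forms. The term `q` in the last factor accounts for both
types of top rank, so all other forms are bounded by the term with `(q ^ 2 - 1) * (q - 1)`, the
numerator in `rankFactor_ratio`. -/
theorem pow_le_even {q : ℚ} (hq : 2 ≤ q) (h : ℕ) :
    q ^ (2 * (h + 1) * (2 * (h + 1) + 1) / 2) ≤
      q ^ h * (q ^ (h + 1) ^ 2 * rankFactor q (2 * (h + 1)) (h + 1)) *
        (q + (q ^ 2 - 1) * (q - 1)) := by
  have hb := le_rankFactor_even hq h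
  have hE := rankFactor_pos (q := q) (by linarith) (le_refl (2 * (h + 1)))
  have hexp : 2 * (h + 1) * (2 * (h + 1) + 1) / 2 = h + (h + 1) ^ 2 + (h + 1) ^ 2 + 1 := by
    rw [mul_assoc, Nat.mul_div_cancel_left _ two_pos]; ring
  rw [hexp, pow_succ, pow_add, pow_add]
  have hY : 0 < q ^ (2 * h + 3) := by positivity
  have ha : 0 < q ^ (h + 1) ^ 2 := by positivity
  have hx : 0 < q ^ h := by positivity
  generalize rankFactor q (2 * (h + 1)) (h + 1) = E at *
  generalize q ^ (h + 1) ^ 2 = a at *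
  generalize q ^ (2 * h + 3) = Y at *
  generalize q ^ h = x at *
  have h1 : a * (q ^ 3 - q - 1) ≤ E * (q ^ 2 * (q + 1)) := by
    refine le_of_mul_le_mul_right ?_ hY
    have : 0 ≤ a * q ^ 3 := by positivity
    linarith
  have hN : 0 ≤ q + (q ^ 2 - 1) * (q - 1) :=
    add_nonneg (by linarith) (mul_nonneg (by nlinarith) (by linarith))
  -- At `q = 2` this reads `24 ≤ 25`, so the constant of `le_rankFactor_even` has hardly any slack.
  have h2 : q ^ 3 * (q + 1) ≤ (q ^ 3 - q - 1) * (q + (q ^ 2 - 1) * (q - 1)) := by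
    have : 0 ≤ q ^ 4 * (q - 2) * (q + 1) :=
      mul_nonneg (mul_nonneg (by positivity) (by linarith)) (by linarith)
    nlinarith
  have h3 : a * q ≤ E * (q + (q ^ 2 - 1) * (q - 1)) := by
    have hc : 0 < q ^ 2 * (q + 1) := by positivity
    refine le_of_mul_le_mul_right ?_ hc
    have h4 := mul_le_mul_of_nonneg_left h2 ha.le
    have h5 := mul_le_mul_of_nonneg_right h1 hN
    linarith
  have h6 := mul_le_mul_of_nonneg_left h3 (mul_pos hx ha).le
  linarith

theorem pow_le_odd {q : ℚ} (hq : 2 ≤ q) (h : ℕ) :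
    q ^ ((2 * (h + 1) + 1) * (2 * (h + 1) + 1 + 1) / 2) ≤
      q ^ h * (q ^ (h + 1) ^ 2 * rankFactor q (2 * (h + 1) + 1) (h + 1)) *
        (q + (q ^ 3 - 1) * (q ^ 2 - 1)) := by
  have hb := le_rankFactor_odd hq (h + 1)
  have hE := rankFactor_pos (q := q) (by linarith) (Nat.le_succ (2 * (h + 1)))
  have hexp : (2 * (h + 1) + 1) * (2 * (h + 1) + 1 + 1) / 2 =
      h + (h + 1) ^ 2 + ((h + 1) ^ 2 + 2 * (h + 1)) + 2 := by
    rw [show 2 * (h + 1) + 1 + 1 = (h + 2) * 2 by ring, ← mul_assoc,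
      Nat.mul_div_cancel _ two_pos]
    ring
  rw [hexp, pow_add, pow_add, pow_add]
  have hY : 0 < q ^ (2 * (h + 1) + 1) := by positivity
  have ha : 0 < q ^ (h + 1) ^ 2 := by positivity
  have hx : 0 < q ^ h := by positivity
  have hB : 0 < q ^ ((h + 1) ^ 2 + 2 * (h + 1)) := by positivity
  generalize rankFactor q (2 * (h + 1) + 1) (h + 1) = E at *
  generalize q ^ ((h + 1) ^ 2 + 2 * (h + 1)) = b at *
  generalize q ^ (h + 1) ^ 2 = a at *
  generalize q ^ (2 * (h + 1) + 1) = Y at *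
  generalize q ^ h = x at *
  have h1 : b * (q ^ 3 - q - 1) ≤ E * (q * (q ^ 2 - 1)) := by
    refine le_of_mul_le_mul_right ?_ hY
    have : 0 ≤ b * q := by positivity
    linarith
  have hq2 : 0 < q ^ 2 - 1 := by nlinarith
  have hq3 : 5 ≤ q ^ 3 - q - 1 := by nlinarith [sq_nonneg (q - 2)]
  have hN : 0 ≤ q + (q ^ 3 - 1) * (q ^ 2 - 1) :=
    add_nonneg (by linarith) (mul_nonneg (by linarith) hq2.le)
  have h2 : q ^ 2 * (q * (q ^ 2 - 1)) ≤ (q ^ 3 - q - 1) * (q + (q ^ 3 - 1) * (q ^ 2 - 1)) := by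
    have s1 : q ^ 3 * (q ^ 2 - 1) ≤ 5 * ((q ^ 3 - 1) * (q ^ 2 - 1)) := by nlinarith
    have s2 : 5 * ((q ^ 3 - 1) * (q ^ 2 - 1)) ≤ 5 * (q + (q ^ 3 - 1) * (q ^ 2 - 1)) := by linarith
    have s3 := mul_le_mul_of_nonneg_right hq3 hN
    linarith
  have h3 : b * q ^ 2 ≤ E * (q + (q ^ 3 - 1) * (q ^ 2 - 1)) := by
    have hc : 0 < q * (q ^ 2 - 1) := by positivity
    refine le_of_mul_le_mul_right ?_ hc
    have h4 := mul_le_mul_of_nonneg_left h2 hB.le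
    have h5 := mul_le_mul_of_nonneg_right h1 hN
    linarith
  have h6 := mul_le_mul_of_nonneg_left h3 (mul_pos hx ha).le
  linarith

/-- `M` plays the number of forms of defect zero. Bounding it by the complement of the top rank
makes the numerator `N` of the ratio between the two ranks cancel. -/
theorem mul_typeCount_le_of_pow_le {q : ℚ} (hq : 2 ≤ q) {n h : ℕ} (hn : 2 * (h + 1) ≤ n) {ε : ℚ}
    (hε : ε = 1 ∨ ε = -1 ∧ 1 ≤ h) {M N : ℚ}
    (hN : N = (q ^ (n - 2 * h) - 1) * (q ^ (n - (2 * h + 1)) - 1))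
    (hpow : q ^ (n * (n + 1) / 2) ≤
      q ^ h * (q ^ (h + 1) ^ 2 * rankFactor q n (h + 1)) * (q + N))
    (hM : M + typeCount q n (h + 1) 1 + typeCount q n (h + 1) (-1) ≤ q ^ (n * (n + 1) / 2)) :
    M * typeCount q n h ε ≤ typeCount q n (h + 1) ε ^ 2 := by
  have hq1 : 1 < q := by linarith
  have hE0 := rankFactor_pos hq1 (n := n) (h := h) (by omega)
  have hE1 := rankFactor_pos hq1 (n := n) (h := h + 1) (by omega)
  have r := rankFactor_ratio q n h
  rw [← hN, show q ^ (2 * (h + 1)) = (q ^ h) ^ 2 * q ^ 2 by ring] at r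
  have hs := pow_add_sign_pos hq1 hε
  have hx := one_le_pow_of_one_lt hq1 h
  have ha : 0 < q ^ h ^ 2 := by positivity
  have hε' : ε = 1 ∨ ε = -1 := by tauto
  have hM' : M ≤ q ^ h * (q ^ (h + 1) ^ 2 * rankFactor q n (h + 1)) * N := by
    have : typeCount q n (h + 1) 1 + typeCount q n (h + 1) (-1) =
        q ^ h * (q ^ (h + 1) ^ 2 * rankFactor q n (h + 1)) * q := by
      rw [typeCount, typeCount, pow_succ q h]; ring
    linarith
  have hN0 : 0 ≤ N := by
    rw [hN]
    exact mul_nonneg (sub_nonneg.2 (one_le_pow_of_one_lt hq1 _))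
      (sub_nonneg.2 (one_le_pow_of_one_lt hq1 _))
  rw [typeCount, typeCount, pow_succ q h]
  rw [show q ^ (h + 1) ^ 2 = q ^ h ^ 2 * (q ^ h) ^ 2 * q by ring] at *
  clear hpow hM hN
  generalize rankFactor q n (h + 1) = E1 at *
  generalize rankFactor q n h = E0 at *
  generalize q ^ h ^ 2 = a at *
  generalize q ^ h = x at *
  have hxq : 2 ≤ x * q := by nlinarith
  have hD : 0 < x ^ 2 * q ^ 2 - 1 := by nlinarith
  have hsign : 2 * (x + ε) * (x ^ 2 * q ^ 2 - 1) ≤ (x * q + ε) ^ 2 * (x * q) := by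
    have t0 : 0 ≤ q * (q - 2) * x ^ 2 - (q - 2) * x := by
      have : 0 ≤ (q - 2) * x * (q * x - 1) :=
        mul_nonneg (mul_nonneg (by linarith) (by linarith)) (by linarith)
      linarith
    have t0' : 0 ≤ (q - 2) * x := mul_nonneg (by linarith) (by linarith)
    -- Since `x ^ 2 * q ^ 2 - 1 = (x * q - ε) * (x * q + ε)`, one factor `x * q + ε` can be removed
    -- from `hsign`.
    have t1 : 2 * (x + ε) * (x * q - ε) ≤ (x * q + ε) * (x * q) := by
      rcases hε' with rfl | rfl <;> linarith
    have t2 : 0 ≤ x * q + ε := by rcases hε' with rfl | rfl <;> linarith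
    have t3 := mul_le_mul_of_nonneg_right t1 t2
    have t4 : (x * q - ε) * (x * q + ε) = x ^ 2 * q ^ 2 - 1 := by
      rcases hε' with rfl | rfl <;> ring
    calc _ = 2 * (x + ε) * (x * q - ε) * (x * q + ε) := by rw [← t4]; ring
      _ ≤ _ := t3
      _ = _ := by ring
  have hK : 0 ≤ a * (x + ε) / 2 * E0 := by positivity
  have hstep : E0 * N * (2 * (x + ε)) ≤ E1 * ((x * q + ε) ^ 2 * (x * q)) := by
    rw [r, mul_div_assoc', div_mul_eq_mul_div, le_div_iff₀ hD]
    have := mul_le_mul_of_nonneg_left hsign (mul_nonneg hE0.le hN0)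
    linarith
  have hK2 : 0 ≤ a ^ 2 * x ^ 3 * q * E1 / 4 := by positivity
  calc M * (a * (x + ε) / 2 * E0) ≤ x * (a * x ^ 2 * q * E1) * N * (a * (x + ε) / 2 * E0) := by
        gcongr
    _ = a ^ 2 * x ^ 3 * q * E1 / 4 * (E0 * N * (2 * (x + ε))) := by ring
    _ ≤ a ^ 2 * x ^ 3 * q * E1 / 4 * (E1 * ((x * q + ε) ^ 2 * (x * q))) := by gcongr
    _ = _ := by ring

theorem mul_typeCount_le {q : ℚ} (hq : 2 ≤ q) {n h : ℕ} (hn : n / 2 = h + 1) {ε : ℚ}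
    (hε : ε = 1 ∨ ε = -1 ∧ 1 ≤ h) {M : ℚ}
    (hM : M + typeCount q n (h + 1) 1 + typeCount q n (h + 1) (-1) ≤ q ^ (n * (n + 1) / 2)) :
    M * typeCount q n h ε ≤ typeCount q n (h + 1) ε ^ 2 := by
  obtain rfl | rfl : n = 2 * (h + 1) ∨ n = 2 * (h + 1) + 1 := by omega
  · refine mul_typeCount_le_of_pow_le hq (by omega) hε rfl ?_ hM
    rw [show 2 * (h + 1) - 2 * h = 2 by omega, show 2 * (h + 1) - (2 * h + 1) = 1 by omega, pow_one]
    exact pow_le_even hq h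
  · refine mul_typeCount_le_of_pow_le hq (by omega) hε rfl ?_ hM
    rw [show 2 * (h + 1) + 1 - 2 * h = 3 by omega,
      show 2 * (h + 1) + 1 - (2 * h + 1) = 2 by omega]
    exact pow_le_odd hq h

end FiniteQuadraticForm

/-! ### The ordered list of defects and log-concavity away from defect zero -/

namespace FiniteQuadraticForm

variable {F : Type*} [Field F]

/-- The possible defects of quadratic forms in `n` variables, divided
by `q * (q - 1)`, in decreasing order: `q ^ (n - 1), …, q ^ (n - 1 - n / 2), 0,
-q ^ (n - 1 - n / 2), …, -q ^ (n - 2)`. -/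
def level (q : ℤ) (n j : ℕ) : ℤ :=
  if j ≤ n / 2 then q ^ (n - 1 - j)
  else if j = n / 2 + 1 then 0
  else -q ^ (n - 1 - (2 * (n / 2) + 2 - j))

theorem level_of_le (q : ℤ) {n j : ℕ} (hj : j ≤ n / 2) : level q n j = q ^ (n - 1 - j) := if_pos hj

theorem level_mid (q : ℤ) (n : ℕ) : level q n (n / 2 + 1) = 0 := by
  rw [level, if_neg (by omega), if_pos rfl]

theorem level_of_gt (q : ℤ) {n j h : ℕ} (hj : n / 2 + 1 < j) (hh : h + j = 2 * (n / 2) + 2) :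
    level q n j = -q ^ (n - 1 - h) := by
  rw [level, if_neg (by omega), if_neg (by omega), show 2 * (n / 2) + 2 - j = h by omega]

theorem level_strictAnti {q : ℤ} (hq : 1 < q) {n j k : ℕ} (hn : 2 ≤ n) (hjk : j < k)
    (hk : k ≤ 2 * (n / 2) + 1) : level q n k < level q n j := by
  have hpos (i : ℕ) : 0 < q ^ i := by positivity
  rcases Nat.lt_trichotomy k (n / 2 + 1) with h | rfl | h
  · rw [level_of_le q (by omega), level_of_le q (by omega)]
    exact pow_lt_pow_right₀ hq (by omega)
  · rw [level_mid, level_of_le q (by omega)]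
    exact hpos _
  · rw [level_of_gt q (h := 2 * (n / 2) + 2 - k) h (by omega)]
    rcases Nat.lt_trichotomy j (n / 2 + 1) with h' | rfl | h'
    · rw [level_of_le q (by omega)]
      linarith [hpos (n - 1 - (2 * (n / 2) + 2 - k)), hpos (n - 1 - j)]
    · rw [level_mid]
      linarith [hpos (n - 1 - (2 * (n / 2) + 2 - k))]
    · rw [level_of_gt q (h := 2 * (n / 2) + 2 - j) h' (by omega)]
      exact neg_lt_neg (pow_lt_pow_right₀ hq (by omega))

theorem level_le {q : ℤ} (hq : 1 < q) {n j : ℕ} (hn : 2 ≤ n) (hj : j ≤ 2 * (n / 2) + 1) :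
    level q n j ≤ q ^ (n - 1) := by
  have h0 : level q n 0 = q ^ (n - 1) := level_of_le q (Nat.zero_le _)
  rcases Nat.eq_zero_or_pos j with rfl | h
  · exact h0.le
  · exact h0 ▸ (level_strictAnti hq hn h hj).le

variable (F) in
/-- The number of quadratic forms in `n` variables whose defect is the `j`-th possible one. -/
noncomputable def levelCount (n j : ℕ) : ℕ :=
  formCount F (Fin n → F) ((Nat.card F - 1) * Nat.card F * level (Nat.card F) n j)

theorem levelCount_of_le [Finite F] {n j : ℕ} (hn : 2 ≤ n) (hj : j ≤ n / 2) :
    (levelCount F n j : ℚ) = typeCount (Nat.card F) n j 1 := by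
  have h := formCount_eq_typeCount (F := F) n j (by omega) 1 (Or.inl rfl)
  rw [Int.cast_one] at h
  rw [levelCount, level_of_le _ hj, ← h, show n - j = n - 1 - j + 1 by omega, pow_succ']
  congr 2
  ring

theorem levelCount_of_gt [Finite F] {n j h : ℕ} (hn : 2 ≤ n) (hj : n / 2 + 1 < j)
    (hh : h + j = 2 * (n / 2) + 2) :
    (levelCount F n j : ℚ) = typeCount (Nat.card F) n h (-1) := by
  have h' := formCount_eq_typeCount (F := F) n h (by omega) (-1) (Or.inr rfl)
  rw [Int.cast_neg, Int.cast_one] at h'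
  rw [levelCount, level_of_gt _ hj hh, ← h', show n - h = n - 1 - h + 1 by omega, pow_succ']
  congr 2
  ring

theorem levelCount_mid [Finite F] (n : ℕ) :
    levelCount F n (n / 2 + 1) = formCount F (Fin n → F) 0 := by
  rw [levelCount, level_mid, mul_zero]

theorem formCount_zero_pos [Finite F] (n : ℕ) : 0 < formCount F (Fin (n + 1) → F) 0 := by
  have hq := one_lt_card_int (F := F)
  induction n with
  | zero =>
    have := formCount_one_zero (F := F)
    zify
    linarith
  | succ n ih =>
    have h := formCount_rec_mul (F := F) n 0
    rw [mul_zero, zero_add] at h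
    have h1 : 1 < (Nat.card F : ℤ) ^ (n + 1) := one_lt_pow₀ hq (by omega)
    have h2 : 1 < (Nat.card F : ℤ) ^ (n + 2) := one_lt_pow₀ hq (by omega)
    rw [Nat.pos_iff_ne_zero]
    intro h0
    rw [show n + 1 + 1 = n + 2 from rfl] at h0
    rw [h0, Nat.cast_zero, zero_mul] at h
    have h3 : (0 : ℤ) < formCount F (Fin (n + 1) → F) 0 := by exact_mod_cast ih
    have h4 : (0 : ℤ) ≤ ((Nat.card F : ℤ) ^ (n + 1) - 1) * ((Nat.card F : ℤ) ^ (n + 1) *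
          formCount F (Fin n → F) 0) :=
      mul_nonneg (by linarith) (mul_nonneg (by linarith) (Nat.cast_nonneg _))
    have := mul_pos (by linarith : (0 : ℤ) < (Nat.card F : ℤ) ^ (n + 2) - 1) (add_pos_of_pos_of_nonneg h3 h4)
    linarith

theorem two_le_card_rat [Finite F] : (2 : ℚ) ≤ Nat.card F := by
  exact_mod_cast Finite.one_lt_card (α := F)

/-- No level may be skipped: log-concavity compares neighbours among the weights that occur, so
consecutive levels must be consecutive weights. -/
theorem levelCount_ne_zero [Finite F] {n j : ℕ} (hn : 2 ≤ n) (hj : j ≤ 2 * (n / 2) + 1) :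
    levelCount F n j ≠ 0 := by
  have hq : (1 : ℚ) < Nat.card F := by linarith [two_le_card_rat (F := F)]
  rcases Nat.lt_trichotomy j (n / 2 + 1) with h | rfl | h
  · have h1 := levelCount_of_le (F := F) hn (Nat.lt_succ_iff.1 h)
    have h2 := typeCount_pos hq (n := n) (h := j) (by omega) (Or.inl rfl)
    rw [← h1] at h2
    exact_mod_cast h2.ne'
  · rw [levelCount_mid]
    obtain ⟨k, rfl⟩ := Nat.exists_eq_add_of_le hn
    rw [show 2 + k = k + 1 + 1 by ring]
    exact (formCount_zero_pos _).ne'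
  · have h1 := levelCount_of_gt (F := F) (h := 2 * (n / 2) + 2 - j) hn h (by omega)
    have h2 := typeCount_pos hq (n := n) (h := 2 * (n / 2) + 2 - j) (by omega)
      (Or.inr ⟨rfl, by omega⟩)
    rw [← h1] at h2
    exact_mod_cast h2.ne'

theorem exists_level_of_formCount_ne_zero [Finite F] {n : ℕ} (hn : 2 ≤ n) {d : ℤ}
    (hd : formCount F (Fin n → F) d ≠ 0) :
    ∃ j ≤ 2 * (n / 2) + 1, d = (Nat.card F - 1) * Nat.card F * level (Nat.card F) n j := by
  rcases eq_or_eq_of_formCount_ne_zero n d hd with rfl | ⟨h, hh, ε, hε, rfl⟩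
  · exact ⟨n / 2 + 1, by omega, by rw [level_mid, mul_zero]⟩
  · have h1 := formCount_eq_typeCount (F := F) n h hh ε hε
    have hh2 : h ≤ n / 2 := by
      by_contra hcon
      rw [typeCount, rankFactor_eq_zero _ (by omega), mul_zero] at h1
      exact hd (by exact_mod_cast h1)
    have hexp : n - h = n - 1 - h + 1 := by omega
    rcases hε with rfl | rfl
    · refine ⟨h, by omega, ?_⟩
      rw [level_of_le _ hh2, hexp]
      ring
    · have hh0 : h ≠ 0 := by
        rintro rfl
        rw [typeCount] at h1
        norm_num at h1
        exact hd (by rw [Nat.sub_zero]; convert h1 using 2; ring)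
      refine ⟨2 * (n / 2) + 2 - h, by omega, ?_⟩
      rw [level_of_gt _ (h := h) (by omega) (by omega), hexp]
      ring

theorem formCount_mid_add_le [Finite F] {n h : ℕ} (hh : h ≤ n) :
    (formCount F (Fin n → F) 0 : ℚ) + typeCount (Nat.card F) n h 1 +
      typeCount (Nat.card F) n h (-1) ≤ (Nat.card F : ℚ) ^ (n * (n + 1) / 2) := by
  have hq := one_lt_card_int (F := F)
  have h1 := formCount_eq_typeCount (F := F) n h hh 1 (Or.inl rfl)
  have h2 := formCount_eq_typeCount (F := F) n h hh (-1) (Or.inr rfl)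
  rw [Int.cast_neg, Int.cast_one] at h2
  rw [Int.cast_one] at h1
  have hpos : 0 < ((Nat.card F : ℤ) - 1) * (Nat.card F : ℤ) ^ (n - h) :=
    mul_pos (by linarith) (by positivity)
  have hsum := sum_formCount_le (F := F) (V := Fin n → F)
    {0, 1 * ((Nat.card F : ℤ) - 1) * (Nat.card F : ℤ) ^ (n - h),
      -1 * ((Nat.card F : ℤ) - 1) * (Nat.card F : ℤ) ^ (n - h)}
  rw [Finset.sum_insert, Finset.sum_pair, card_form (n := n) (by simp)] at hsum
  · rw [← h1, ← h2, add_assoc]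
    exact_mod_cast hsum
  · rw [one_mul, neg_one_mul, neg_mul]
    linarith
  · simp only [Finset.mem_insert, Finset.mem_singleton, not_or, one_mul, neg_mul]
    constructor <;> linarith

/-- Log-concavity of the numbers of forms by defect, except at defect zero. -/
theorem levelCount_mul_le [Finite F] {n j : ℕ} (hn : 2 ≤ n) (hj : 1 ≤ j)
    (hj' : j + 1 ≤ 2 * (n / 2) + 1) (hne : j ≠ n / 2 + 1) :
    levelCount F n (j - 1) * levelCount F n (j + 1) ≤ levelCount F n j ^ 2 := by
  have hq := two_le_card_rat (F := F)
  suffices h : (levelCount F n (j - 1) : ℚ) * levelCount F n (j + 1) ≤ levelCount F n j ^ 2 by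
    exact_mod_cast h
  rcases Nat.lt_or_gt_of_ne hne with h | h
  · obtain ⟨i, rfl⟩ := Nat.exists_eq_add_of_le' hj
    rw [Nat.add_sub_cancel, levelCount_of_le (j := i) hn (by omega),
      levelCount_of_le (j := i + 1) hn (by omega)]
    rcases Nat.lt_or_ge (i + 1) (n / 2) with h2 | h2
    · rw [levelCount_of_le (j := i + 1 + 1) hn (by omega)]
      exact typeCount_mul_le hq (by omega) (Or.inl rfl)
    · have hi : n / 2 = i + 1 := by omega
      -- The right neighbour of the last hyperbolic level is defect zero, where only the complement
      -- bound is available.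
      rw [← hi, levelCount_mid, hi, mul_comm]
      exact mul_typeCount_le hq hi (Or.inl rfl) (formCount_mid_add_le (by omega))
  · obtain ⟨i, hi⟩ : ∃ i, i + (j + 1) = 2 * (n / 2) + 2 := ⟨2 * (n / 2) + 2 - (j + 1), by omega⟩
    rw [levelCount_of_gt (j := j + 1) (h := i) hn (by omega) hi,
      levelCount_of_gt (j := j) (h := i + 1) hn (by omega) (by omega)]
    rcases Nat.lt_or_ge (n / 2 + 1) (j - 1) with h2 | h2
    · rw [levelCount_of_gt (j := j - 1) (h := i + 2) hn (by omega) (by omega), mul_comm]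
      exact typeCount_mul_le hq (by omega) (Or.inr ⟨rfl, by omega⟩)
    · rw [show j - 1 = n / 2 + 1 by omega, levelCount_mid]
      exact mul_typeCount_le hq (by omega) (Or.inr ⟨rfl, by omega⟩) (formCount_mid_add_le (by omega))

end FiniteQuadraticForm

/-! ### From strictly increasing weights to the weight list of a code -/

namespace CodeLC

theorem weightList_eq {F ι : Type*} [Field F] [DecidableEq F] [Fintype ι]
    {C : Submodule F (ι → F)} {s : ℕ → ℕ} {N : ℕ}
    (hs : ∀ j k, j < k → k < N → s j < s k)
    (hC : ∀ w, weightCount C w ≠ 0 ↔ ∃ j < N, w = s j) :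
    weightList C = (List.range N).map s := by
  have hle : ∀ w, weightCount C w ≠ 0 → w < Fintype.card ι + 1 := by
    intro w hw
    obtain ⟨c, -, rfl⟩ := Set.nonempty_of_ncard_ne_zero hw
    exact Nat.lt_succ_of_le hammingNorm_le_card_fintype
  have p1 : (weightList C).Pairwise (· < ·) := List.pairwise_lt_range.filter _
  have p2 : ((List.range N).map s).Pairwise (· < ·) := by
    rw [List.pairwise_map]
    refine List.pairwise_lt_range.imp_of_mem ?_
    intro a b _ hb hab
    exact hs a b hab (List.mem_range.1 hb)
  refine List.Perm.eq_of_pairwise (le := (· < ·)) (fun a b _ _ h h' => absurd h h'.asymm) p1 p2 ?_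
  rw [List.perm_ext_iff_of_nodup (p1.imp ne_of_lt) (p2.imp ne_of_lt)]
  intro w
  simp only [weightList, List.mem_filter, List.mem_range, List.mem_map, decide_eq_true_eq]
  constructor
  · rintro ⟨-, h⟩
    obtain ⟨j, hj, rfl⟩ := (hC w).1 h
    exact ⟨j, hj, rfl⟩
  · rintro ⟨j, hj, rfl⟩
    have := (hC _).2 ⟨j, hj, rfl⟩
    exact ⟨hle _ this, this⟩

/-- If log-concavity holds at all interior indices but possibly `k`, the code is log-concave or
`1`-gap log-concave, and a gap can only occur at `k`. -/
theorem logConcave_or_gap {F ι : Type*} [Field F] [DecidableEq F] [Fintype ι]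
    {C : Submodule F (ι → F)} {s : ℕ → ℕ} {N k : ℕ}
    (hs : ∀ j k, j < k → k < N → s j < s k)
    (hC : ∀ w, weightCount C w ≠ 0 ↔ ∃ j < N, w = s j)
    (hlc : ∀ j, 1 ≤ j → j + 1 < N → j ≠ k →
      weightCount C (s (j - 1)) * weightCount C (s (j + 1)) ≤ weightCount C (s j) ^ 2) :
    (IsLogConcave C ∨ IsGapLogConcave 1 C) ∧
      ∀ i ∈ gapIndices (nonzeroWeightDist C), (weightList C).getD i 0 = s k := by
  have hW := weightList_eq hs hC
  have hlen : (nonzeroWeightDist C).length = N := by simp [nonzeroWeightDist, hW]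
  have hget : ∀ j < N, (nonzeroWeightDist C).getD j 0 = weightCount C (s j) := by
    intro j hj
    simp [nonzeroWeightDist, hW, hj]
  have hgap : ∀ i ∈ gapIndices (nonzeroWeightDist C), i = k ∧ i < N := by
    intro i hi
    rw [gapIndices, Finset.mem_filter, hlen, Finset.mem_range] at hi
    obtain ⟨hiN, h1, h2, h3⟩ := hi
    refine ⟨?_, hiN⟩
    by_contra hne
    rw [hget i hiN, hget _ (by omega), hget _ h2] at h3
    exact absurd (hlc i h1 h2 hne) h3.not_ge
  constructor
  · rcases (gapIndices (nonzeroWeightDist C)).eq_empty_or_nonempty with h | ⟨i, hi⟩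
    · left
      intro i h1 h2
      by_contra h3
      have : i ∈ gapIndices (nonzeroWeightDist C) := by
        rw [gapIndices, Finset.mem_filter, Finset.mem_range]
        exact ⟨by omega, h1, h2, not_le.1 h3⟩
      rw [h] at this
      exact absurd this (Finset.notMem_empty i)
    · right
      rw [IsGapLogConcave, IsGapLogConcaveSeq, Finset.card_eq_one]
      refine ⟨i, Finset.eq_singleton_iff_unique_mem.2 ⟨hi, fun j hj => ?_⟩⟩
      rw [(hgap i hi).1, (hgap j hj).1]
  · intro i hi
    obtain ⟨rfl, hiN⟩ := hgap i hi
    simp [hW, hiN]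

end CodeLC

/-! ### Transfer from quadratic forms to the two codes -/

namespace FiniteQuadraticForm

open CodeLC

variable {F : Type*} [Field F]

theorem zeroCount_add_card [Finite F] {n : ℕ} (Q : QuadraticForm F (Fin n → F)) :
    zeroCount Q + Nat.card {x // Q x ≠ 0} = Nat.card F ^ n := by
  classical
  have := Fintype.ofFinite F
  rw [zeroCount, ← card_fin_fun, Nat.card_eq_fintype_card, Nat.card_eq_fintype_card,
    Nat.card_eq_fintype_card, Fintype.card_subtype_compl]
  have := Fintype.card_subtype_le (fun x => Q x = 0)
  omega

theorem defect_eq [Finite F] {n : ℕ} (Q : QuadraticForm F (Fin n → F)) :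
    defect Q = (Nat.card F - 1) * (Nat.card F : ℤ) ^ n -
      Nat.card F * (Nat.card {x // Q x ≠ 0} : ℤ) := by
  have h : (zeroCount Q : ℤ) + (Nat.card {x // Q x ≠ 0} : ℤ) = (Nat.card F : ℤ) ^ n := by
    exact_mod_cast zeroCount_add_card Q
  rw [defect, card_fin_fun]
  push_cast
  linear_combination (Nat.card F : ℤ) * h

/-- A code whose codewords correspond to quadratic forms, the weight being proportional to the
number of vectors at which the form does not vanish. -/
theorem logConcave_or_gap_of_forms [Finite F] [DecidableEq F] {ι : Type*} [Fintype ι]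
    {C : Submodule F (ι → F)} {n t : ℕ} (hn : 2 ≤ n) (ht : 0 < t)
    (hC : ∀ w, weightCount C w = Nat.card {Q : QuadraticForm F (Fin n → F) //
      w * (Nat.card F - 1) = t * Nat.card {x // Q x ≠ 0}}) :
    (IsLogConcave C ∨ IsGapLogConcave 1 C) ∧
      ∀ i ∈ gapIndices (nonzeroWeightDist C),
        (weightList C).getD i 0 = t * Nat.card F ^ (n - 1) := by
  have hq := one_lt_card_int (F := F)
  have hq1 : 1 ≤ Nat.card F := Nat.card_pos
  -- Levels decrease with `j`, so the weights `t * u j` increase; `level_le` ensures that `toNat`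
  -- truncates nothing.
  let u : ℕ → ℕ := fun j => ((Nat.card F : ℤ) ^ (n - 1) - level (Nat.card F) n j).toNat
  have hu : ∀ j ≤ 2 * (n / 2) + 1,
      (u j : ℤ) = (Nat.card F : ℤ) ^ (n - 1) - level (Nat.card F) n j := fun j hj =>
    Int.toNat_of_nonneg (sub_nonneg.2 (level_le hq hn hj))
  have hpow : (Nat.card F : ℤ) ^ n = Nat.card F * (Nat.card F : ℤ) ^ (n - 1) := by
    rw [← pow_succ', Nat.sub_add_cancel (by omega)]
  have hiff : ∀ (w : ℕ) (Q : QuadraticForm F (Fin n → F)),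
      w * (Nat.card F - 1) = t * Nat.card {x // Q x ≠ 0} ↔
      (w : ℤ) * (Nat.card F * (Nat.card F - 1)) =
        t * ((Nat.card F - 1) * (Nat.card F : ℤ) ^ n - defect Q) := by
    intro w Q
    rw [defect_eq Q, ← Int.natCast_inj]
    push_cast [hq1]
    constructor
    · intro h
      linear_combination (Nat.card F : ℤ) * h
    · intro h
      apply mul_left_cancel₀ (by linarith : (Nat.card F : ℤ) ≠ 0)
      linear_combination h
  have htz : (t : ℤ) ≠ 0 := by exact_mod_cast ht.ne'
  have hK : ((Nat.card F : ℤ) * (Nat.card F - 1)) ≠ 0 :=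
    mul_ne_zero (by linarith) (by linarith)
  have hcount : ∀ j ≤ 2 * (n / 2) + 1, weightCount C (t * u j) = levelCount F n j := by
    intro j hj
    rw [hC, levelCount, formCount]
    refine Nat.card_congr (Equiv.subtypeEquivRight fun Q => ?_)
    rw [hiff]
    push_cast
    rw [hu j hj, hpow]
    constructor
    · intro h
      apply mul_left_cancel₀ htz
      linear_combination h
    · intro h
      linear_combination (t : ℤ) * h
  have hsupp : ∀ w, weightCount C w ≠ 0 ↔ ∃ j < 2 * (n / 2) + 2, w = t * u j := by
    intro w
    constructor
    · intro hw
      rw [hC, Ne, Finite.card_eq_zero_iff, isEmpty_subtype] at hw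
      push Not at hw
      obtain ⟨Q, hQ⟩ := hw
      obtain ⟨j, hj, hd⟩ := exists_level_of_formCount_ne_zero (F := F) hn (d := defect Q)
        fun h => formCount_eq_zero_iff.1 h Q rfl
      refine ⟨j, by omega, ?_⟩
      rw [hiff, hd, hpow] at hQ
      have : (w : ℤ) = t * u j := by
        rw [hu j hj]
        apply mul_right_cancel₀ hK
        rw [hQ]
        ring
      exact_mod_cast this
    · rintro ⟨j, hj, rfl⟩
      rw [hcount j (by omega)]
      exact levelCount_ne_zero hn (by omega)
  have hmid : u (n / 2 + 1) = Nat.card F ^ (n - 1) := by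
    have := hu (n / 2 + 1) (by omega)
    rw [level_mid, sub_zero] at this
    exact_mod_cast this
  rw [← hmid]
  refine logConcave_or_gap (s := fun j => t * u j) (N := 2 * (n / 2) + 2) ?_ hsupp ?_
  · intro j k hjk hk
    refine Nat.mul_lt_mul_of_pos_left ?_ ht
    have h1 := level_strictAnti hq hn hjk (by omega)
    zify
    rw [hu j (by omega), hu k (by omega)]
    linarith
  · intro j h1 h2 h3
    rw [hcount _ (by omega), hcount _ (by omega), hcount _ (by omega)]
    exact levelCount_mul_le hn h1 (by omega) h3

theorem weightCount_eq_card {ι : Type*} [Fintype ι] [DecidableEq F] {n : ℕ} {p : ι → Fin n → F}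
    (hp : Function.Injective fun (Q : QuadraticForm F (Fin n → F)) i => Q (p i)) (w : ℕ) :
    weightCount (homogeneousEvalCode 2 p) w =
      Nat.card {Q : QuadraticForm F (Fin n → F) // Nat.card {i // Q (p i) ≠ 0} = w} := by
  have hnorm (c : ι → F) : hammingNorm c = Nat.card {i // c i ≠ 0} := by
    rw [hammingNorm, Nat.card_eq_fintype_card, Fintype.card_subtype]
  rw [weightCount, ← Nat.card_coe_set_eq]
  refine (Nat.card_eq_of_bijective (fun Q => ⟨fun i => Q.1 (p i),
    mem_homogeneousEvalCode_iff.2 ⟨Q.1, rfl⟩, (hnorm _).trans Q.2⟩) ⟨?_, ?_⟩).symm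
  · intro Q Q' h
    exact Subtype.ext (hp (congrArg Subtype.val h))
  · rintro ⟨c, hc, hw⟩
    obtain ⟨Q, rfl⟩ := mem_homogeneousEvalCode_iff.1 hc
    exact ⟨⟨Q, (hnorm _).symm.trans hw⟩, rfl⟩

variable {m : ℕ} {v : Projectivization F (Fin (m + 1) → F) → (Fin (m + 1) → F)}

theorem exists_unit_smul_rep (hv : IsRepresentatives v) {x : Fin (m + 1) → F} (hx : x ≠ 0) :
    ∃ (P : Projectivization F (Fin (m + 1) → F)) (a : Fˣ), a • v P = x := by
  obtain ⟨h, hP⟩ := hv (Projectivization.mk F x hx)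
  obtain ⟨a, ha⟩ := (Projectivization.mk_eq_mk_iff F _ _ hx h).1 hP.symm
  exact ⟨_, a, ha⟩

theorem map_units_smul (Q : QuadraticForm F (Fin (m + 1) → F)) (a : Fˣ) (x : Fin (m + 1) → F) :
    Q (a • x) = (a : F) * a * Q x := by
  rw [Units.smul_def, QuadraticMap.map_smul, smul_eq_mul]

theorem injective_eval_rep (hv : IsRepresentatives v) :
    Function.Injective fun (Q : QuadraticForm F (Fin (m + 1) → F)) P => Q (v P) := by
  intro Q Q' h
  ext x
  by_cases hx : x = 0
  · rw [hx, QuadraticMap.map_zero, QuadraticMap.map_zero]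
  · obtain ⟨P, a, rfl⟩ := exists_unit_smul_rep hv hx
    rw [map_units_smul, map_units_smul]
    congr 1
    exact congrFun h P

/-- As `Q (a • x) = a ^ 2 * Q x`, nonvanishing depends only on the projective point, and every point
carries as many nonzero vectors as there are units. The weight is thus independent of the
representatives. -/
theorem card_rep_mul (hv : IsRepresentatives v) (Q : QuadraticForm F (Fin (m + 1) → F)) :
    Nat.card {P // Q (v P) ≠ 0} * Nat.card Fˣ = Nat.card {x // Q x ≠ 0} := by
  rw [← Nat.card_prod]
  have h (P : {P // Q (v P) ≠ 0}) (a : Fˣ) : Q (a • v P.1) ≠ 0 := by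
    rw [map_units_smul]
    exact mul_ne_zero (mul_ne_zero a.ne_zero a.ne_zero) P.2
  refine Nat.card_eq_of_bijective (fun z => ⟨z.2 • v z.1.1, h z.1 z.2⟩) ⟨?_, ?_⟩
  · rintro ⟨⟨P, hP⟩, a⟩ ⟨⟨P', hP'⟩, b⟩ hab
    have hab : a • v P = b • v P' := congrArg Subtype.val hab
    obtain ⟨h1, h2⟩ := hv P
    obtain ⟨h1', h2'⟩ := hv P'
    have hPP : P = P' := by
      rw [← h2, ← h2', Projectivization.mk_eq_mk_iff]
      exact ⟨a⁻¹ * b, by rw [mul_smul, ← hab, inv_smul_smul]⟩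
    subst hPP
    have : a = b := by
      ext
      exact smul_left_injective F h1 hab
    rw [this]
  · rintro ⟨x, hx⟩
    obtain ⟨P, a, rfl⟩ := exists_unit_smul_rep hv (x := x) (by
      rintro rfl
      exact hx (QuadraticMap.map_zero Q))
    refine ⟨⟨⟨P, fun h0 => hx ?_⟩, a⟩, rfl⟩
    rw [map_units_smul, h0, mul_zero]

end FiniteQuadraticForm

theorem mainTheorem4 (F : Type*) [Field F] [Fintype F] [DecidableEq F] (m : ℕ) (hm : 2 ≤ m) :
    ((CodeLC.IsLogConcave (CodeLC.HRM F 2 m) ∨ CodeLC.IsGapLogConcave 1 (CodeLC.HRM F 2 m)) ∧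
      ∀ i ∈ CodeLC.gapIndices (CodeLC.nonzeroWeightDist (CodeLC.HRM F 2 m)),
        (CodeLC.weightList (CodeLC.HRM F 2 m)).getD i 0 =
          Fintype.card F ^ m - Fintype.card F ^ (m - 1)) ∧
    ∀ [Fintype (Projectivization F (Fin (m + 1) → F))]
      (v : Projectivization F (Fin (m + 1) → F) → (Fin (m + 1) → F)),
      CodeLC.IsRepresentatives v →
      (CodeLC.IsLogConcave (CodeLC.PRM 2 m v) ∨ CodeLC.IsGapLogConcave 1 (CodeLC.PRM 2 m v)) ∧
      ∀ i ∈ CodeLC.gapIndices (CodeLC.nonzeroWeightDist (CodeLC.PRM 2 m v)),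
        (CodeLC.weightList (CodeLC.PRM 2 m v)).getD i 0 = Fintype.card F ^ m := by
  have hq : 1 < Fintype.card F := Fintype.one_lt_card
  constructor
  -- The choice `t = q - 1` makes the weight equal to the number of nonvanishing vectors.
  · have h := FiniteQuadraticForm.logConcave_or_gap_of_forms (F := F) (C := CodeLC.HRM F 2 m)
      (t := Nat.card F - 1) hm (by rw [Nat.card_eq_fintype_card]; omega) (fun w => by
        rw [CodeLC.HRM, FiniteQuadraticForm.weightCount_eq_card DFunLike.coe_injective]
        refine Nat.card_congr (Equiv.subtypeEquivRight fun Q => ?_)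
        rw [mul_comm, Nat.mul_right_inj (by rw [Nat.card_eq_fintype_card]; omega), eq_comm])
    have he : (Nat.card F - 1) * Nat.card F ^ (m - 1) =
        Fintype.card F ^ m - Fintype.card F ^ (m - 1) := by
      rw [Nat.card_eq_fintype_card, Nat.sub_mul, one_mul, ← pow_succ', Nat.sub_add_cancel (by omega)]
    rw [← he]
    exact h
  · intro _ v hv
    -- With `t = 1`, `q - 1` nonvanishing vectors count as one coordinate, and `n = m + 1` puts the
    -- exceptional weight at `q ^ m`.
    have h := FiniteQuadraticForm.logConcave_or_gap_of_forms (F := F) (C := CodeLC.PRM 2 m v)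
      (n := m + 1) (t := 1) (by omega) one_pos (fun w => by
        rw [CodeLC.PRM, FiniteQuadraticForm.weightCount_eq_card
          (FiniteQuadraticForm.injective_eval_rep hv)]
        refine Nat.card_congr (Equiv.subtypeEquivRight fun Q => ?_)
        rw [one_mul, ← FiniteQuadraticForm.card_rep_mul hv, Nat.card_units,
          Nat.mul_left_inj (by rw [Nat.card_eq_fintype_card]; omega), eq_comm])
    rw [one_mul, Nat.add_sub_cancel, Nat.card_eq_fintype_card] at h
    exact h
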